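/- Let $d\ge 1$. For the simple symmetric random walk (SSRW) $Z$ on $\mathbb{Z}^d$ let $G_n(z)=\mathbb{E}^{Z_0=0}\big[\#\{t\le n: Z_t=z\}\big]$. The potential kernel $$a(z)=\lim_{n\to\infty}\big(G_n(0)-G_n(z)\big),\qquad z\in\mathbb{Z}^d,$$ exists as a finite limit. For a measure $\nu$ on $\mathbb{Z}^d$ put $A.\nu(y)=-\int a(y-x)\,\nu(dx)$. A set $D\subseteq\mathbb{Z}\times\mathbb{Z}^d$ is of Root type if $(t,m)\in D$ implies $(s,m)\in D$ for all $s<t$, and of Rost type if $(t,m)\in D$ implies $(s,m)\in D$ for all $s>t$. Let $\lambda$ be a probability measure on $\mathbb{Z}^d$, let $X$ be an SSRW on $\mathbb{Z}^d$ with $X_0\sim\lambda$, let $Y$ be an SSRW on $\mathbb{Z}^d$ started in $y\in\mathbb{Z}^d$ (with expectation $\mathbb{E}_y$), and let $T\in\mathbb{N}=\{0,1,\dots\}$. For a set $D$ of either type put $\rho^D=\inf\{t\in\mathbb{N}:(t,X_t)\notin D\}$, let $\mu^D$ be the law of $X_{\rho^D}$, and let $\mu^D_T$ be the law of $X$ stopped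 upon leaving $D\cap(\{0,\dots,T-1\}\times\mathbb{Z}^d)$. Suprema below are over stopping times $\tau\le T$ of the natural filtration of $Y$. Put $$\tau^D=\inf\{t\in\mathbb{N}:(T-t,Y_t)\notin D\}\wedge T .$$ Assume that $(X_{\rho^D\wedge t})_{t\in\mathbb{N}}$ is uniformly integrable (in particular bounded in $L^1$). Then $\rho^D<\infty$ almost surely, the integrals defining $A.\lambda$, $A.\mu^D$ and $A.\mu^D_T$ converge absolutely at every point, the expectations below exist for every such $\tau$, $\tau^D$ is a stopping time of the natural filtration of $Y$, and the following hold. (Root) If $D$ is of Root type, then $$A.\mu^D_T(y)=\mathbb{E}_y\big[A.\mu^D(Y_{\tau^D})\mathbf 1_{\tau^D<T}+A.\lambda(Y_{\tau^D})\mathbf 1_{\tau^D=T}\big]=\sup_{\tau\le T}\mathbb{E}_y\big[A.\mu^D(Y_{\tau})\mathbf 1_{\tau<T}+A.\lambda(Y_{\tau})\mathbf 1_{\tau=T}\big].$$ (Rost) If $D$ is of Rost type, then $$A.\mu^D(y)-A.\mu^D_T(y)=\mathbb{E}_y\big[(A.\mu^D-A.\lambda)(Y_{\tau^D})\big]=\sup_{\tau\le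 T}\mathbb{E}_y\big[(A.\mu^D-A.\lambda)(Y_{\tau})\big].$$ In both cases the supremum is attained at $\tau^D$. -/

import Mathlib

open MeasureTheory ProbabilityTheory Filter Topology

noncomputable section

/-- The integer lattice `ℤ^d`. -/
abbrev Zd (d : ℕ) : Type := Fin d → ℤ

/-- The step distribution of the simple symmetric random walk on `ℤ^d`: the uniform distribution
on the `2d` unit vectors `± e_i`. -/
def stepLaw (d : ℕ) : Measure (Zd d) :=
  (2 * (d : ENNReal))⁻¹ •
    ∑ i : Fin d, (Measure.dirac (Pi.single i 1) + Measure.dirac (Pi.single i (-1)))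

/-- `X` is a simple symmetric random walk on `ℤ^d` under `P`, with arbitrary, possibly random,
initial position: every increment is uniform on the unit vectors and independent of the past. -/
structure IsSSRW {d : ℕ} {Ω : Type*} [MeasurableSpace Ω] (P : Measure Ω)
    (X : ℕ → Ω → Zd d) : Prop where
  measurable : ∀ t, Measurable (X t)
  step_law : ∀ t, P.map (fun ω => X (t + 1) ω - X t ω) = stepLaw d
  step_indep : ∀ t, IndepFun (fun ω => X (t + 1) ω - X t ω)
    (fun ω (s : Set.Iic t) => X s ω) P

theorem IsSSRW.stronglyMeasurable {d : ℕ} {Ω : Type*} [MeasurableSpace Ω] {P : Measure Ω}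
    {X : ℕ → Ω → Zd d} (hX : IsSSRW P X) (t : ℕ) : StronglyMeasurable (X t) :=
  (hX.measurable t).stronglyMeasurable

/-! ### The potential kernel -/

/-- The law of an i.i.d. sequence of steps. -/
def stepsLaw (d : ℕ) : Measure (ℕ → Zd d) :=
  Measure.infinitePi (fun _ : ℕ => stepLaw d)

/-- The walk started in the origin with the given steps. -/
def walkFromOrigin {d : ℕ} (t : ℕ) (ξ : ℕ → Zd d) : Zd d :=
  ∑ i ∈ Finset.range t, ξ i

/-- `G_n(z)`: the expected number of times `t ≤ n` at which the simple symmetric random walk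
started in the origin is at `z`. -/
def expectedVisits (d n : ℕ) (z : Zd d) : ℝ :=
  ∫ ξ, (((Finset.range (n + 1)).filter (fun t => walkFromOrigin t ξ = z)).card : ℝ) ∂(stepsLaw d)

/-- The potential kernel `a(z) = lim_n (G_n(0) - G_n(z))`. -/
def potentialKernel (d : ℕ) (z : Zd d) : ℝ :=
  limUnder atTop (fun n : ℕ => expectedVisits d n 0 - expectedVisits d n z)

/-- The potential `A.ν(y) = - ∫ a(y - x) ν(dx)`. -/
def potential {d : ℕ} (ν : Measure (Zd d)) (y : Zd d) : ℝ :=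
  - ∫ x, potentialKernel d (y - x) ∂ν

/-! ### Continuation sets and exit times -/

/-- Root-type continuation sets: with `(t, m)`, all `(s, m)`, `s < t`, belong to the set. -/
def IsRootType {d : ℕ} (D : Set (ℤ × Zd d)) : Prop :=
  ∀ (t : ℤ) (m : Zd d), (t, m) ∈ D → ∀ s < t, (s, m) ∈ D

/-- Rost-type continuation sets: with `(t, m)`, all `(s, m)`, `s > t`, belong to the set. -/
def IsRostType {d : ℕ} (D : Set (ℤ × Zd d)) : Prop :=
  ∀ (t : ℤ) (m : Zd d), (t, m) ∈ D → ∀ s > t, (s, m) ∈ D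

/-- `inf {t ∈ ℕ : (t, X_t) ∉ D}`, with value `⊤` if `(t, X_t)` never leaves `D`. -/
def exitTime {d : ℕ} {Ω : Type*} (D : Set (ℤ × Zd d)) (X : ℕ → Ω → Zd d) :
    Ω → WithTop ℕ :=
  hittingAfter (fun (t : ℕ) ω => ((t : ℤ), X t ω)) Dᶜ 0

/-- `inf {t ∈ ℕ : (T - t, Y_t) ∉ D} ∧ T`. -/
def reversedExitTime {d : ℕ} {Ω : Type*} (D : Set (ℤ × Zd d)) (T : ℕ)
    (Y : ℕ → Ω → Zd d) : Ω → WithTop ℕ :=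
  fun ω => min (hittingAfter (fun (t : ℕ) ω => ((T : ℤ) - (t : ℤ), Y t ω)) Dᶜ 0 ω) (T : WithTop ℕ)

/-- The law of `X` stopped upon leaving `D`. -/
def exitLaw {d : ℕ} {Ω : Type*} [MeasurableSpace Ω] (P : Measure Ω) (X : ℕ → Ω → Zd d)
    (D : Set (ℤ × Zd d)) : Measure (Zd d) :=
  P.map (stoppedValue X (exitTime D X))

/-- The truncation `D ∩ ({0, …, T-1} × ℤ^d)`. -/
def truncate {d : ℕ} (D : Set (ℤ × Zd d)) (T : ℕ) : Set (ℤ × Zd d) :=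
  D ∩ (Set.Ico (0 : ℤ) (T : ℤ) ×ˢ Set.univ)

/-! ### The optimal stopping problems -/

/-- The stopping times `τ ≤ T` with respect to the natural filtration of `Y`. -/
def stoppingTimesUpTo {d : ℕ} {Ω : Type*} [MeasurableSpace Ω] (Y : ℕ → Ω → Zd d)
    (hY : ∀ t, StronglyMeasurable (Y t)) (T : ℕ) : Set (Ω → WithTop ℕ) :=
  {τ | IsStoppingTime (Filtration.natural Y hY) τ ∧ ∀ ω, τ ω ≤ (T : WithTop ℕ)}

/-- `A.μ(Y_τ) 1_{τ < T} + A.ν(Y_τ) 1_{τ = T}`. -/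
def rootReward {d : ℕ} {Ω : Type*} (μ ν : Measure (Zd d)) (T : ℕ)
    (Y : ℕ → Ω → Zd d) (τ : Ω → WithTop ℕ) (ω : Ω) : ℝ :=
  {ω | τ ω < (T : WithTop ℕ)}.indicator (fun ω => potential μ (stoppedValue Y τ ω)) ω +
    {ω | τ ω = (T : WithTop ℕ)}.indicator (fun ω => potential ν (stoppedValue Y τ ω)) ω

/-- `(A.μ - A.ν)(Y_τ)`. -/
def rostReward {d : ℕ} {Ω : Type*} (μ ν : Measure (Zd d))
    (Y : ℕ → Ω → Zd d) (τ : Ω → WithTop ℕ) (ω : Ω) : ℝ :=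
  potential μ (stoppedValue Y τ ω) - potential ν (stoppedValue Y τ ω)

/-- The potential of `ν` is given by a convergent integral at every point. -/
def HasPotential {d : ℕ} (ν : Measure (Zd d)) : Prop :=
  ∀ y, Integrable (fun x => potentialKernel d (y - x)) ν

end

/-!
The potentials `A.μ_t` of the laws `μ_t` of the walk `X`, stopped at time `t` or upon leaving `D`,
solve a discrete obstacle problem in the remaining time `t`, and a verification argument identifies
the solution of an obstacle problem with the value of a stopping problem for the walk `Y`.

*The potential kernel.* By Fourier inversion on the torus, `G_n(0) - G_n(z)` is the integral of
`(1 - φ ^ (n + 1)) (1 - cos (2π z·θ)) / (1 - φ)`, where `φ` is the characteristic function of a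
step. The quotient `(1 - cos (2π z·θ)) / (1 - φ)` is at most `d ^ 2` times the sum over the
coordinates of the unnormalised Fejér kernels of order `|z i|` (`one_sub_torusCos_le`), whose means
are `|z i|`. Dominated convergence gives the limit `a`, and the same bound gives `a z ≤ d ^ 3 ‖z‖`,
in all dimensions at once. Averaging the integrand over the neighbours of `z` shows that the
Laplacian of `a` is the unit mass in the origin (`latticeAvg_potentialKernel`).

*Flow of potentials.* Since `v ↦ a (y - v)` is harmonic off `y`, Dynkin's formula for the stopped
walk shows that `A.μ_t y` decreases in the step from `t` to `t + 1` by the probability that `X` is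
in `y` at time `t` and not yet stopped (`IsSSRW.stoppedPotential_succ`), while its spatial average
is `A.μ_{t + 1} y` minus the probability that `X` was stopped in `y` by time `t`
(`IsSSRW.latticeAvg_stoppedPotential`). Uniform integrability and the linear growth of `a` yield
`A.μ_t → A.μ^D`. That `X` leaves `D` at all is martingale convergence.

*Barriers.* Let `D` be of Root type. If `(t + 1, y) ∈ D`, then `X` cannot have been stopped in `y`
by time `t`, so that `A.μ_{t + 1} y` is the average of `A.μ_t`; if `(t + 1, y) ∉ D`, then `X` visits
`y` no more after time `t` without being stopped, so that `A.μ_{t + 1} y = A.μ^D y`. If `D` is of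
Rost type, the same dichotomy holds for `A.μ^D - A.μ_t`, with obstacle `A.μ^D - A.λ`: in `D`, the
walk is not stopped in `y` after time `t`, and off `D` it has not visited `y` before being stopped.

*Verification.* In both cases the resulting function of remaining time and position dominates the
payoff, is superharmonic in space-time, harmonic in `D` and equal to the payoff off `D`. Hence it
is the value of the stopping problem, attained by the exit time of the time-reversed walk from `D`
(`IsSSRW.optimal_stopping`).
-/

noncomputable section

/-! ### The transition operator and the Markov property -/

/-- The transition operator of the simple symmetric random walk: the average of `f` over the
`2d` neighbours of `z`. -/
def latticeAvg {d : ℕ} (f : Zd d → ℝ) (z : Zd d) : ℝ :=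
  (2 * (d : ℝ))⁻¹ * ∑ i : Fin d, (f (z + Pi.single i 1) + f (z + Pi.single i (-1)))

theorem isProbabilityMeasure_stepLaw {d : ℕ} (hd : 0 < d) : IsProbabilityMeasure (stepLaw d) := by
  constructor
  have h : (2 * (d : ENNReal)) ≠ 0 := by simp; omega
  have h' : (2 * (d : ENNReal)) ≠ ⊤ := ENNReal.mul_ne_top (by simp) (by simp)
  simp only [stepLaw, Measure.smul_apply, Measure.finsetSum_apply, Measure.add_apply,
    measure_univ, Finset.sum_const, Finset.card_univ, Fintype.card_fin, nsmul_eq_mul, smul_eq_mul]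
  rw [one_add_one_eq_two, mul_comm (d : ENNReal), ENNReal.inv_mul_cancel h h']

theorem ae_stepLaw {d : ℕ} {p : Zd d → Prop}
    (h : ∀ i, p (Pi.single i 1) ∧ p (Pi.single i (-1))) : ∀ᵐ u ∂stepLaw d, p u := by
  rw [ae_iff]
  simp [stepLaw, h]

theorem integrable_stepLaw {d : ℕ} (hd : 0 < d) (f : Zd d → ℝ) : Integrable f (stepLaw d) := by
  refine Integrable.smul_measure ?_ (by simp; omega)
  exact integrable_finsetSum_measure.2 fun i _ =>
    (integrable_dirac (by simp)).add_measure (integrable_dirac (by simp))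

theorem integral_stepLaw {d : ℕ} (f : Zd d → ℝ) (z : Zd d) :
    ∫ u, f (z + u) ∂stepLaw d = latticeAvg f z := by
  have hi : ∀ v : Zd d, Integrable (fun u => f (z + u)) (Measure.dirac v) :=
    fun v => integrable_dirac (by simp)
  rw [stepLaw, integral_smul_measure, integral_finsetSum_measure
    (fun i _ => (hi _).add_measure (hi _))]
  simp only [integral_add_measure (hi _) (hi _), integral_dirac, latticeAvg]
  simp

theorem integral_latticeAvg {d : ℕ} {α : Type*} [MeasurableSpace α] (μ : Measure α)
    (g : α → Zd d → ℝ)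
    (hg : ∀ v, Integrable (fun x => g x v) μ) (z : Zd d) :
    ∫ x, latticeAvg (g x) z ∂μ = latticeAvg (fun v => ∫ x, g x v ∂μ) z := by
  simp only [latticeAvg]
  rw [integral_const_mul, integral_finsetSum _ fun i _ => by exact (hg _).add (hg _)]
  congr 1
  exact Finset.sum_congr rfl fun i _ => integral_add (hg _) (hg _)

section Markov

variable {d : ℕ} {Ω : Type*} [MeasurableSpace Ω] {P : Measure Ω} {X : ℕ → Ω → Zd d}

/-- The simple Markov property: on an event `A` that depends on the path up to time `t` only,
the conditional expectation of `f (X (t + 1))` is the average of `f` over the neighbours of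
`X t`. -/
theorem IsSSRW.setIntegral_succ [IsProbabilityMeasure P] (hd : 0 < d) (hX : IsSSRW P X) (t : ℕ)
    {A : Set Ω}
    (hA : MeasurableSet[Filtration.natural X hX.stronglyMeasurable t] A) (f : Zd d → ℝ)
    (hf : ∀ i, IntegrableOn (fun ω => f (X t ω + Pi.single i 1)) A P ∧
      IntegrableOn (fun ω => f (X t ω + Pi.single i (-1))) A P) :
    IntegrableOn (fun ω => f (X (t + 1) ω)) A P ∧
      ∫ ω in A, f (X (t + 1) ω) ∂P = ∫ ω in A, latticeAvg f (X t ω) ∂P := by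
  have hA' : MeasurableSet A := Filtration.le _ t A hA
  rw [Filtration.natural_eq_comap] at hA
  obtain ⟨B, hB, rfl⟩ := hA
  set W : Ω → (Set.Iic t → Zd d) := fun ω s => X s ω with hW
  set U : Ω → Zd d := fun ω => X (t + 1) ω - X t ω with hU
  have hWm : Measurable W := measurable_pi_lambda _ fun s => hX.measurable s
  have hUm : Measurable U := (hX.measurable _).sub (hX.measurable _)
  have := isProbabilityMeasure_stepLaw hd
  have hν : IsProbabilityMeasure (P.map W) := Measure.isProbabilityMeasure_map hWm.aemeasurable
  let F : Zd d × (Set.Iic t → Zd d) → ℝ := fun p =>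
    B.indicator (fun w => f (w ⟨t, Set.self_mem_Iic⟩ + p.1)) p.2
  have hFm : Measurable F := by
    have h1 : Measurable fun p : Zd d × (Set.Iic t → Zd d) => f (p.2 ⟨t, Set.self_mem_Iic⟩ + p.1) :=
      (Measurable.of_discrete (f := f)).comp
        (((measurable_pi_apply _).comp measurable_snd).add measurable_fst)
    have h2 : F = (Prod.snd ⁻¹' B).indicator
        fun p : Zd d × (Set.Iic t → Zd d) => f (p.2 ⟨t, Set.self_mem_Iic⟩ + p.1) := by
      ext p; rfl
    rw [h2]
    exact h1.indicator (measurable_snd hB)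
  -- the step `U` and the path `W` up to time `t` are independent
  have hlaw : P.map (fun ω => (U ω, W ω)) = (stepLaw d).prod (P.map W) := by
    rw [(indepFun_iff_map_prod_eq_prod_map_map hUm.aemeasurable hWm.aemeasurable).1
      (hX.step_indep t), hX.step_law t]
  have hFU : ∀ u, (fun ω => F (u, W ω)) = (W ⁻¹' B).indicator (fun ω => f (X t ω + u)) := by
    intro u; ext ω; rfl
  have hFint : ∀ u, IntegrableOn (fun ω => f (X t ω + u)) (W ⁻¹' B) P →
      Integrable (fun w => F (u, w)) (P.map W) := by
    intro u hu
    rw [integrable_map_measure (f := W) (g := fun w => F (u, w))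
      (hFm.comp measurable_prodMk_left).aestronglyMeasurable hWm.aemeasurable]
    change Integrable (fun ω => F (u, W ω)) P
    rw [hFU, integrable_indicator_iff hA']
    exact hu
  have hFI : Integrable F ((stepLaw d).prod (P.map W)) := by
    rw [integrable_prod_iff hFm.aestronglyMeasurable]
    exact ⟨ae_stepLaw fun i => ⟨hFint _ (hf i).1, hFint _ (hf i).2⟩, integrable_stepLaw hd _⟩
  have hcomp : (fun ω => F (U ω, W ω)) = (W ⁻¹' B).indicator (fun ω => f (X (t + 1) ω)) := by
    ext ω
    change B.indicator (fun w => f (w ⟨t, Set.self_mem_Iic⟩ + U ω)) (W ω) = _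
    simp only [Set.indicator, hU, hW, Set.mem_preimage, add_sub_cancel]
    rfl
  have hm : Measurable fun ω => (U ω, W ω) := hUm.prodMk hWm
  have hI : Integrable (fun ω => F (U ω, W ω)) P := by
    have := hFI
    rw [← hlaw, integrable_map_measure hFm.aestronglyMeasurable hm.aemeasurable] at this
    exact this
  constructor
  · rwa [hcomp, integrable_indicator_iff hA'] at hI
  · rw [← integral_indicator hA', ← hcomp,
      ← integral_map (φ := fun ω => (U ω, W ω)) hm.aemeasurable hFm.aestronglyMeasurable, hlaw,
      integral_prod_symm _ hFI, integral_map hWm.aemeasurable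
        hFm.stronglyMeasurable.integral_prod_left'.aestronglyMeasurable, ← integral_indicator hA']
    congr 1
    ext ω
    by_cases hω : W ω ∈ B
    · rw [Set.indicator_of_mem (show ω ∈ W ⁻¹' B from hω), ← integral_stepLaw]
      exact integral_congr_ae (ae_of_all _ fun u => Set.indicator_of_mem hω _)
    · rw [Set.indicator_of_notMem (show ω ∉ W ⁻¹' B from hω)]
      simp [F, hω]

theorem IsSSRW.ae_step (hX : IsSSRW P X) (t : ℕ) {p : Zd d → Prop}
    (h : ∀ i, p (Pi.single i 1) ∧ p (Pi.single i (-1))) : ∀ᵐ ω ∂P, p (X (t + 1) ω - X t ω) := by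
  have := ae_stepLaw h
  rw [← hX.step_law t] at this
  exact ae_of_ae_map ((hX.measurable _).sub (hX.measurable _)).aemeasurable this

end Markov

/-! ### The walk with independent steps -/

theorem measurable_walkFromOrigin {d : ℕ} (t : ℕ) :
    Measurable (walkFromOrigin t : (ℕ → Zd d) → Zd d) := by
  unfold walkFromOrigin
  fun_prop

theorem isSSRW_walkFromOrigin {d : ℕ} (hd : 0 < d) :
    IsSSRW (stepsLaw d) (walkFromOrigin (d := d)) := by
  have := isProbabilityMeasure_stepLaw hd
  have hstep : ∀ t, (fun ξ : ℕ → Zd d => walkFromOrigin (t + 1) ξ - walkFromOrigin t ξ)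
      = fun ξ => ξ t := by
    intro t; ext ξ : 1
    simp [walkFromOrigin, Finset.sum_range_succ]
  refine ⟨measurable_walkFromOrigin, fun t => ?_, fun t => ?_⟩
  · rw [hstep]
    exact Measure.infinitePi_map_eval (fun _ => stepLaw d) t
  · rw [hstep]
    have h := (iIndepFun_infinitePi (P := fun _ : ℕ => stepLaw d) (X := fun _ ω => ω)
      (fun _ => measurable_id)).indepFun_finset {t} (Finset.range t) (by simp)
      (fun i => measurable_pi_apply i)
    have h2 := h.comp (φ := fun v : ({t} : Finset ℕ) → Zd d => v ⟨t, by simp⟩)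
      (ψ := fun v : Finset.range t → Zd d => fun s : Set.Iic t =>
        ∑ i : Finset.range s, v ⟨i, by
          have := Finset.mem_range.1 i.2
          have := s.2
          simp only [Set.mem_Iic] at this
          simp; omega⟩) (measurable_pi_apply (X := fun _ => Zd d) _)
      (measurable_pi_lambda _ fun s =>
          Finset.measurable_sum _ fun i _ => measurable_pi_apply (X := fun _ => Zd d) _)
    convert! h2 using 1
    ext ξ s : 2
    simp only [Function.comp, walkFromOrigin]
    exact (Finset.sum_coe_sort (Finset.range s) fun i => ξ i).symm

theorem isProbabilityMeasure_stepsLaw {d : ℕ} (hd : 0 < d) :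
    IsProbabilityMeasure (stepsLaw d) := by
  have := isProbabilityMeasure_stepLaw hd
  unfold stepsLaw
  infer_instance

/-- The `t`-step transition probability from the origin to `z`. -/
def transitionProb (d t : ℕ) (z : Zd d) : ℝ :=
  (stepsLaw d).real {ξ | walkFromOrigin t ξ = z}

theorem measurableSet_walkFromOrigin {d : ℕ} (t : ℕ) (z : Zd d) :
    MeasurableSet {ξ : ℕ → Zd d | walkFromOrigin t ξ = z} :=
  measurable_walkFromOrigin t (measurableSet_singleton z)

theorem expectedVisits_eq_sum {d : ℕ} (hd : 0 < d) (n : ℕ) (z : Zd d) :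
    expectedVisits d n z = ∑ t ∈ Finset.range (n + 1), transitionProb d t z := by
  have := isProbabilityMeasure_stepsLaw hd
  have h : ∀ ξ : ℕ → Zd d,
      (((Finset.range (n + 1)).filter (fun t => walkFromOrigin t ξ = z)).card : ℝ) =
        ∑ t ∈ Finset.range (n + 1),
          {ξ : ℕ → Zd d | walkFromOrigin t ξ = z}.indicator (fun _ => (1 : ℝ)) ξ := by
    intro ξ
    rw [Finset.card_filter]
    push_cast
    simp [Set.indicator]
  simp only [expectedVisits, h]
  rw [integral_finsetSum]
  · refine Finset.sum_congr rfl fun t _ => ?_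
    rw [integral_indicator (measurableSet_walkFromOrigin t z)]
    simp [transitionProb]
  · exact fun t _ => (integrable_const _).indicator (measurableSet_walkFromOrigin t z)

theorem transitionProb_zero {d : ℕ} (hd : 0 < d) (z : Zd d) :
    transitionProb d 0 z = if z = 0 then 1 else 0 := by
  have := isProbabilityMeasure_stepsLaw hd
  by_cases h : z = 0
  · simp [transitionProb, walkFromOrigin, h]
  · simp [transitionProb, walkFromOrigin, h, Ne.symm h]

theorem transitionProb_succ {d : ℕ} (hd : 0 < d) (t : ℕ) (z : Zd d) :
    transitionProb d (t + 1) z = latticeAvg (transitionProb d t) z := by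
  have := isProbabilityMeasure_stepsLaw hd
  have hind : ∀ (s : ℕ) (v : Zd d), (fun ξ => if walkFromOrigin s ξ = v then (1 : ℝ) else 0) =
      {ξ | walkFromOrigin s ξ = v}.indicator 1 := by
    intro s v; ext ξ; simp [Set.indicator]
  have hp : ∀ (s : ℕ) (v : Zd d), transitionProb d s v =
      ∫ ξ, (if walkFromOrigin s ξ = v then (1 : ℝ) else 0) ∂stepsLaw d := by
    intro s v
    rw [transitionProb, ← integral_indicator_one (measurableSet_walkFromOrigin s v), hind]
  have hint : ∀ (s : ℕ) (v : Zd d), Integrable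
      (fun ξ => if walkFromOrigin s ξ = v then (1 : ℝ) else 0) (stepsLaw d) := by
    intro s v
    rw [hind]
    exact (integrable_const (1 : ℝ)).indicator (measurableSet_walkFromOrigin s v)
  have hint' : ∀ u : Zd d, Integrable
      (fun ξ => if walkFromOrigin t ξ + u = z then (1 : ℝ) else 0) (stepsLaw d) := by
    intro u
    simp only [← eq_sub_iff_add_eq]
    exact hint t _
  have h := ((isSSRW_walkFromOrigin hd).setIntegral_succ hd t MeasurableSet.univ
    (fun v => if v = z then 1 else 0) (fun i => ⟨(hint' _).integrableOn, (hint' _).integrableOn⟩)).2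
  simp only [Measure.restrict_univ] at h
  rw [hp, h]
  have hswap : ∀ ξ : ℕ → Zd d,
      latticeAvg (fun v => if v = z then (1 : ℝ) else 0) (walkFromOrigin t ξ) =
        latticeAvg (fun v => if walkFromOrigin t ξ = v then (1 : ℝ) else 0) z := by
    intro ξ
    have h1 : ∀ x e : Zd d, (x + e = z) = (x = z + -e) := fun x e =>
      propext eq_add_neg_iff_add_eq.symm
    simp only [latticeAvg, Pi.single_neg, h1, neg_neg]
    congr 1
    exact Finset.sum_congr rfl fun i _ => add_comm _ _
  simp only [hswap]
  rw [integral_latticeAvg _ (fun ξ v => if walkFromOrigin t ξ = v then (1 : ℝ) else 0) (hint t)]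
  simp only [latticeAvg, hp]

/-! ### Fourier analysis on the torus -/

/-- The uniform probability measure on the torus `(ℝ / ℤ)^d`. -/
def torusMeasure (d : ℕ) : Measure (UnitAddTorus (Fin d)) :=
  Measure.pi fun _ => AddCircle.haarAddCircle

instance (d : ℕ) : IsProbabilityMeasure (torusMeasure d) := by
  unfold torusMeasure; infer_instance

/-- The real character `θ ↦ cos (2π z·θ)` of the torus. -/
def torusCos {d : ℕ} (z : Zd d) (θ : UnitAddTorus (Fin d)) : ℝ :=
  (UnitAddTorus.mFourier z θ).re

/-- The characteristic function of the step distribution of the walk. -/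
def stepChar {d : ℕ} (θ : UnitAddTorus (Fin d)) : ℝ :=
  (d : ℝ)⁻¹ * ∑ i : Fin d, torusCos (Pi.single i 1) θ

section

variable {d : ℕ}

theorem norm_mFourier_apply (z : Zd d) (θ : UnitAddTorus (Fin d)) :
    ‖UnitAddTorus.mFourier z θ‖ = 1 := by
  simp only [UnitAddTorus.mFourier, ContinuousMap.coe_mk, norm_prod, fourier_apply,
    Circle.norm_coe, Finset.prod_const_one]

theorem continuous_torusCos (z : Zd d) : Continuous (torusCos z) :=
  Complex.continuous_re.comp (UnitAddTorus.mFourier z).continuous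

theorem continuous_stepChar : Continuous (stepChar (d := d)) :=
  continuous_const.mul (continuous_finsetSum _ fun _ _ => continuous_torusCos _)

theorem integrable_torus {f : UnitAddTorus (Fin d) → ℝ} (hf : Continuous f) :
    Integrable f (torusMeasure d) := by
  obtain ⟨C, hC⟩ := isCompact_univ.exists_bound_of_continuousOn hf.continuousOn
  exact Integrable.of_bound hf.aestronglyMeasurable C (ae_of_all _ fun x => hC x trivial)

theorem torusCos_zero (θ : UnitAddTorus (Fin d)) : torusCos 0 θ = 1 := by
  simp [torusCos, UnitAddTorus.mFourier_zero]

theorem torusCos_neg (z : Zd d) (θ : UnitAddTorus (Fin d)) : torusCos (-z) θ = torusCos z θ := by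
  simp [torusCos, UnitAddTorus.mFourier_neg]

theorem abs_torusCos_le (z : Zd d) (θ : UnitAddTorus (Fin d)) : |torusCos z θ| ≤ 1 :=
  (Complex.abs_re_le_norm _).trans (norm_mFourier_apply z θ).le

theorem one_sub_torusCos (z : Zd d) (θ : UnitAddTorus (Fin d)) :
    1 - torusCos z θ = ‖1 - UnitAddTorus.mFourier z θ‖ ^ 2 / 2 := by
  have h := norm_mFourier_apply z θ
  have h2 : ‖UnitAddTorus.mFourier z θ‖ ^ 2 = 1 := by rw [h]; norm_num
  rw [← Complex.normSq_eq_norm_sq, Complex.normSq_apply] at h2 ⊢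
  simp only [Complex.sub_re, Complex.sub_im, Complex.one_re, Complex.one_im, torusCos]
  nlinarith

/-- Characters are eigenfunctions of the transition operator. -/
theorem latticeAvg_torusCos (z : Zd d) (θ : UnitAddTorus (Fin d)) :
    latticeAvg (fun v => torusCos v θ) z = stepChar θ * torusCos z θ := by
  have h : ∀ i : Fin d, torusCos (z + Pi.single i 1) θ + torusCos (z + Pi.single i (-1)) θ =
      2 * (torusCos (Pi.single i 1) θ * torusCos z θ) := by
    intro i
    simp only [torusCos, Pi.single_neg, UnitAddTorus.mFourier_add, UnitAddTorus.mFourier_neg,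
      Complex.mul_re, Complex.conj_re, Complex.conj_im]
    ring
  simp only [latticeAvg, h, stepChar, ← Finset.mul_sum, ← Finset.sum_mul, mul_inv]
  ring

theorem abs_stepChar_le (θ : UnitAddTorus (Fin d)) (hd : 0 < d) : |stepChar θ| ≤ 1 := by
  have hd' : (0 : ℝ) < d := by exact_mod_cast hd
  rw [stepChar, abs_mul, abs_of_pos (inv_pos.2 hd'), inv_mul_le_iff₀ hd']
  calc |∑ i : Fin d, torusCos (Pi.single i 1) θ|
      ≤ ∑ i : Fin d, |torusCos (Pi.single i 1) θ| := Finset.abs_sum_le_sum_abs _ _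
    _ ≤ ∑ i : Fin d, (1 : ℝ) := Finset.sum_le_sum fun i _ => abs_torusCos_le _ _
    _ = d * 1 := by simp

/-- Orthogonality of characters. -/
theorem integral_mFourier (z : Zd d) :
    ∫ θ, UnitAddTorus.mFourier z θ ∂torusMeasure d = if z = 0 then 1 else 0 := by
  have h1 : ∀ n : ℤ, ∫ x : UnitAddCircle, fourier n x ∂AddCircle.haarAddCircle =
      if n = 0 then (1 : ℂ) else 0 := by
    intro n
    split_ifs with h
    · simp [h]
    · exact integral_eq_zero_of_add_right_eq_neg
        (fourier_add_half_inv_index h (zero_lt_one (α := ℝ)))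
  have h2 := integral_fintype_prod_eq_prod (𝕜 := ℂ) (μ := fun _ : Fin d => AddCircle.haarAddCircle)
    (fun i => fun x : UnitAddCircle => fourier (z i) x)
  rw [torusMeasure]
  refine Eq.trans h2 ?_
  simp only [h1]
  split_ifs with h
  · simp [h]
  · obtain ⟨i, hi⟩ := Function.ne_iff.1 h
    exact Finset.prod_eq_zero (Finset.mem_univ i) (by simpa using hi)

theorem integral_torusCos (z : Zd d) :
    ∫ θ, torusCos z θ ∂torusMeasure d = if z = 0 then 1 else 0 := by
  have h : Integrable (fun θ => UnitAddTorus.mFourier z θ) (torusMeasure d) :=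
    Integrable.of_bound (UnitAddTorus.mFourier z).continuous.aestronglyMeasurable 1
      (ae_of_all _ fun θ => (norm_mFourier_apply z θ).le)
  have h2 := integral_re h
  simp only [RCLike.re_to_complex] at h2
  simp only [torusCos, h2, integral_mFourier]
  split_ifs <;> simp

/-- The geometric sum `∑_{k < n} exp (2π i m k θ_i)`. Its squared modulus is `n` times a Fejér
kernel. -/
def geomKernel (i : Fin d) (m : ℤ) (n : ℕ) (θ : UnitAddTorus (Fin d)) : ℂ :=
  ∑ k ∈ Finset.range n, UnitAddTorus.mFourier (Pi.single i (m * k)) θ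

theorem continuous_geomKernel (i : Fin d) (m : ℤ) (n : ℕ) : Continuous (geomKernel i m n) :=
  continuous_finsetSum _ fun _ _ => (UnitAddTorus.mFourier _).continuous

theorem sq_norm_geomKernel (i : Fin d) (m : ℤ) (n : ℕ) (θ : UnitAddTorus (Fin d)) :
    ‖geomKernel i m n θ‖ ^ 2 = ∑ k ∈ Finset.range n, ∑ l ∈ Finset.range n,
      torusCos (Pi.single i (m * (k - l))) θ := by
  have h : ((‖geomKernel i m n θ‖ ^ 2 : ℝ) : ℂ) =
      geomKernel i m n θ * (starRingEnd ℂ) (geomKernel i m n θ) := by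
    rw [Complex.mul_conj, Complex.normSq_eq_norm_sq]
  have h2 := congrArg Complex.re h
  rw [Complex.ofReal_re] at h2
  rw [h2, geomKernel, map_sum, Finset.sum_mul_sum, Complex.re_sum]
  refine Finset.sum_congr rfl fun k _ => ?_
  rw [Complex.re_sum]
  refine Finset.sum_congr rfl fun l _ => ?_
  rw [← UnitAddTorus.mFourier_neg, ← UnitAddTorus.mFourier_add, ← Pi.single_neg, ← Pi.single_add,
    torusCos, mul_sub, sub_eq_add_neg]

theorem integral_sq_norm_geomKernel (i : Fin d) {m : ℤ} (hm : m ≠ 0) (n : ℕ) :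
    ∫ θ, ‖geomKernel i m n θ‖ ^ 2 ∂torusMeasure d = n := by
  simp only [sq_norm_geomKernel]
  rw [integral_finsetSum _ fun k _ => integrable_finsetSum _ fun l _ =>
    integrable_torus (continuous_torusCos _)]
  have h : ∀ k ∈ Finset.range n, ∫ θ, ∑ l ∈ Finset.range n,
      torusCos (Pi.single i (m * ((k : ℤ) - l))) θ ∂torusMeasure d = 1 := by
    intro k hk
    rw [integral_finsetSum _ fun l _ => integrable_torus (continuous_torusCos _)]
    simp only [integral_torusCos, Pi.single_eq_zero_iff, mul_eq_zero, hm, false_or, sub_eq_zero,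
      Nat.cast_inj]
    simp [Finset.mem_range.1 hk]
  rw [Finset.sum_congr rfl h]
  simp

theorem mFourier_single_mul (i : Fin d) (m : ℤ) (k : ℕ) (θ : UnitAddTorus (Fin d)) :
    UnitAddTorus.mFourier (Pi.single i (m * k)) θ =
      UnitAddTorus.mFourier (Pi.single i m) θ ^ k := by
  induction k with
  | zero => simp [UnitAddTorus.mFourier_zero]
  | succ k ih =>
    rw [pow_succ, ← ih, ← UnitAddTorus.mFourier_add, ← Pi.single_add]
    push_cast
    ring_nf

/-- Summation of the geometric series; the sign of `n` does not matter for the modulus. -/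
theorem norm_one_sub_mFourier_single (i : Fin d) (n : ℤ) (θ : UnitAddTorus (Fin d)) :
    ‖1 - UnitAddTorus.mFourier (Pi.single i n) θ‖ =
      ‖geomKernel i 1 n.natAbs θ‖ * ‖1 - UnitAddTorus.mFourier (Pi.single i 1) θ‖ := by
  have h : ‖1 - UnitAddTorus.mFourier (Pi.single i n) θ‖ =
      ‖1 - UnitAddTorus.mFourier (Pi.single i (1 * (n.natAbs : ℤ))) θ‖ := by
    rw [one_mul]
    rcases Int.natAbs_eq n with hn | hn
    · rw [← hn]
    · conv_lhs => rw [hn]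
      rw [Pi.single_neg, UnitAddTorus.mFourier_neg, ← Complex.norm_conj]
      simp
  rw [h, mFourier_single_mul, geomKernel, ← norm_mul]
  simp only [mFourier_single_mul]
  rw [← norm_neg, neg_sub, ← geom_sum_mul, ← norm_neg, ← mul_neg, neg_sub]

theorem norm_one_sub_prod_le {ι : Type*} (s : Finset ι) (u : ι → ℂ) (hu : ∀ i, ‖u i‖ = 1) :
    ‖1 - ∏ i ∈ s, u i‖ ≤ ∑ i ∈ s, ‖1 - u i‖ := by
  classical
  induction s using Finset.induction_on with
  | empty => simp
  | insert a s ha ih =>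
    rw [Finset.prod_insert ha, Finset.sum_insert ha]
    calc ‖1 - u a * ∏ i ∈ s, u i‖ = ‖(1 - u a) + u a * (1 - ∏ i ∈ s, u i)‖ := by ring_nf
      _ ≤ ‖1 - u a‖ + ‖u a * (1 - ∏ i ∈ s, u i)‖ := norm_add_le _ _
      _ ≤ _ := by rw [norm_mul, hu, one_mul]; gcongr

theorem norm_one_sub_mFourier_le (z : Zd d) (θ : UnitAddTorus (Fin d)) :
    ‖1 - UnitAddTorus.mFourier z θ‖ ≤ ∑ i, ‖1 - UnitAddTorus.mFourier (Pi.single i (z i)) θ‖ := by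
  have h : ∀ i : Fin d, UnitAddTorus.mFourier (Pi.single i (z i)) θ = fourier (z i) (θ i) := by
    intro i
    change ∏ j, fourier ((Pi.single i (z i) : Fin d → ℤ) j) (θ j) = _
    rw [Finset.prod_eq_single i]
    · simp
    · intro j _ hj; simp [hj]
    · simp
  simp only [h]
  exact norm_one_sub_prod_le Finset.univ (fun i => fourier (z i) (θ i)) fun i => by
    rw [fourier_apply, Circle.norm_coe]

theorem one_sub_stepChar (hd : 0 < d) (θ : UnitAddTorus (Fin d)) :
    1 - stepChar θ =
      (d : ℝ)⁻¹ * ∑ i : Fin d, ‖1 - UnitAddTorus.mFourier (Pi.single i 1) θ‖ ^ 2 / 2 := by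
  have hd' : (d : ℝ) ≠ 0 := by exact_mod_cast hd.ne'
  simp only [← one_sub_torusCos, stepChar, Finset.sum_sub_distrib, Finset.sum_const,
    Finset.card_univ, Fintype.card_fin, nsmul_eq_mul, mul_one]
  field_simp

/-- The Fejér kernels dominate the integrand of the potential kernel, in every dimension. -/
theorem one_sub_torusCos_le (hd : 0 < d) (z : Zd d) (θ : UnitAddTorus (Fin d)) :
    1 - torusCos z θ ≤
      (d ^ 2 * ∑ i, ‖geomKernel i 1 (z i).natAbs θ‖ ^ 2) * (1 - stepChar θ) := by
  have hd' : (0 : ℝ) < d := by exact_mod_cast hd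
  have h1 : ‖1 - UnitAddTorus.mFourier z θ‖ ^ 2 ≤
      d * ∑ i, ‖1 - UnitAddTorus.mFourier (Pi.single i (z i)) θ‖ ^ 2 := by
    refine (pow_le_pow_left₀ (norm_nonneg _) (norm_one_sub_mFourier_le z θ) 2).trans ?_
    simpa using sq_sum_le_card_mul_sum_sq (s := (Finset.univ : Finset (Fin d)))
      (f := fun i => ‖1 - UnitAddTorus.mFourier (Pi.single i (z i)) θ‖)
  have h2 : ∀ i : Fin d, ‖1 - UnitAddTorus.mFourier (Pi.single i 1) θ‖ ^ 2 ≤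
      2 * d * (1 - stepChar θ) := by
    intro i
    rw [one_sub_stepChar hd, ← Finset.sum_div]
    have := Finset.single_le_sum
      (f := fun i : Fin d => ‖1 - UnitAddTorus.mFourier (Pi.single i 1) θ‖ ^ 2)
      (fun _ _ => by positivity) (Finset.mem_univ i)
    field_simp
    exact this
  rw [one_sub_torusCos]
  calc ‖1 - UnitAddTorus.mFourier z θ‖ ^ 2 / 2
      ≤ (d * ∑ i, ‖geomKernel i 1 (z i).natAbs θ‖ ^ 2 * (2 * d * (1 - stepChar θ))) / 2 := by
        gcongr
        refine h1.trans ?_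
        gcongr with i
        rw [norm_one_sub_mFourier_single, mul_pow]
        gcongr
        exact h2 i
    _ = _ := by rw [← Finset.sum_mul]; ring

/-- The characteristic function of the step is almost nowhere `± 1`: there `exp (2π i 2θ_0)` is
`1`, so that all the kernels `‖geomKernel‖²` of mean `n` take the value `n²`. -/
theorem ae_abs_stepChar_lt_one (hd : 0 < d) : ∀ᵐ θ ∂torusMeasure d, |stepChar θ| < 1 := by
  have hd' : (0 : ℝ) < d := by exact_mod_cast hd
  let i₀ : Fin d := ⟨0, hd⟩
  set E : Set (UnitAddTorus (Fin d)) := {θ | UnitAddTorus.mFourier (Pi.single i₀ 2) θ = 1} with hE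
  have hEm : MeasurableSet E :=
    (isClosed_eq (UnitAddTorus.mFourier _).continuous continuous_const).measurableSet
  have hsub : ∀ θ, θ ∉ E → |stepChar θ| < 1 := by
    intro θ hθ
    have hlt : |torusCos (Pi.single i₀ 1) θ| < 1 := by
      refine lt_of_le_of_ne (abs_torusCos_le _ _) fun h => hθ ?_
      have h1 := norm_mFourier_apply (Pi.single i₀ 1) θ
      have h2 : ‖UnitAddTorus.mFourier (Pi.single i₀ 1) θ‖ ^ 2 = 1 := by rw [h1]; norm_num
      have h3 : torusCos (Pi.single i₀ 1) θ ^ 2 = 1 := by rw [← sq_abs, h]; norm_num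
      rw [← Complex.normSq_eq_norm_sq, Complex.normSq_apply] at h2
      rw [torusCos] at h3
      have h4 : (UnitAddTorus.mFourier (Pi.single i₀ 1) θ).im = 0 := by nlinarith
      have h5 := mFourier_single_mul i₀ 1 2 θ
      simp only [Nat.cast_ofNat, one_mul] at h5
      rw [hE, Set.mem_ofPred_eq, h5]
      apply Complex.ext
      · simp [pow_two, h4]; nlinarith
      · simp [pow_two, h4]
    rw [stepChar, abs_mul, abs_of_pos (inv_pos.2 hd'), inv_mul_lt_iff₀ hd']
    calc |∑ i : Fin d, torusCos (Pi.single i 1) θ|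
        ≤ ∑ i : Fin d, |torusCos (Pi.single i 1) θ| := Finset.abs_sum_le_sum_abs _ _
      _ < ∑ i : Fin d, (1 : ℝ) := Finset.sum_lt_sum (fun i _ => abs_torusCos_le _ _)
          ⟨i₀, Finset.mem_univ _, hlt⟩
      _ = d * 1 := by simp
  have hEn : ∀ n : ℕ, (n : ℝ) * (torusMeasure d).real E ≤ 1 := by
    intro n
    rcases Nat.eq_zero_or_pos n with rfl | hn
    · simp
    have hn' : (0 : ℝ) < n := by exact_mod_cast hn
    have hint := integrable_torus (((continuous_geomKernel i₀ 2 n).norm).pow 2)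
    have h1 : ∫ θ in E, ‖geomKernel i₀ 2 n θ‖ ^ 2 ∂torusMeasure d ≤ n := by
      rw [← integral_sq_norm_geomKernel i₀ (two_ne_zero) n]
      exact setIntegral_le_integral hint (ae_of_all _ fun θ => by positivity)
    have h2 : ∫ θ in E, ‖geomKernel i₀ 2 n θ‖ ^ 2 ∂torusMeasure d =
        ∫ θ in E, (n : ℝ) ^ 2 ∂torusMeasure d := by
      refine setIntegral_congr_fun hEm fun θ hθ => ?_
      have hθ' : UnitAddTorus.mFourier (Pi.single i₀ 2) θ = 1 := hθ
      simp [geomKernel, mFourier_single_mul, hθ']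
    rw [h2] at h1
    simp only [setIntegral_const, smul_eq_mul] at h1
    nlinarith
  have hE0 : (torusMeasure d).real E = 0 := by
    refine le_antisymm ?_ measureReal_nonneg
    by_contra! h
    obtain ⟨n, hn⟩ := exists_nat_gt (1 / (torusMeasure d).real E)
    rw [div_lt_iff₀ h] at hn
    linarith [hEn n]
  have hE1 : torusMeasure d E = 0 := by
    rwa [measureReal_eq_zero_iff] at hE0
  filter_upwards [compl_mem_ae_iff.2 hE1] with θ hθ using hsub θ hθ

end

/-! ### The potential kernel -/

section Kernel

variable {d : ℕ}

/-- Fourier inversion for the transition probabilities. -/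
theorem transitionProb_eq_integral (hd : 0 < d) (t : ℕ) (z : Zd d) :
    transitionProb d t z = ∫ θ, stepChar θ ^ t * torusCos z θ ∂torusMeasure d := by
  induction t generalizing z with
  | zero => simp [transitionProb_zero hd, integral_torusCos]
  | succ t ih =>
    rw [transitionProb_succ hd, show transitionProb d t = _ from funext ih,
      ← integral_latticeAvg _ (fun θ v => stepChar θ ^ t * torusCos v θ) fun v => integrable_torus
        ((continuous_stepChar.pow t).mul (continuous_torusCos v))]
    congr 1
    ext θ
    rw [pow_succ, mul_assoc, ← latticeAvg_torusCos]
    simp only [latticeAvg, ← mul_add, ← Finset.mul_sum]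
    ring

/-- The integrand in the Fourier representation of the potential kernel. -/
def kernelIntegrand (z : Zd d) (θ : UnitAddTorus (Fin d)) : ℝ :=
  (1 - torusCos z θ) / (1 - stepChar θ)

theorem kernelIntegrand_nonneg (hd : 0 < d) (z : Zd d) (θ : UnitAddTorus (Fin d)) :
    0 ≤ kernelIntegrand z θ :=
  div_nonneg (by linarith [le_abs_self (torusCos z θ), abs_torusCos_le z θ])
    (by linarith [le_abs_self (stepChar θ), abs_stepChar_le θ hd])

theorem kernelIntegrand_le (hd : 0 < d) (z : Zd d) (θ : UnitAddTorus (Fin d)) :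
    kernelIntegrand z θ ≤ d ^ 2 * ∑ i, ‖geomKernel i 1 (z i).natAbs θ‖ ^ 2 :=
  div_le_of_le_mul₀ (by linarith [le_abs_self (stepChar θ), abs_stepChar_le θ hd])
    (by positivity) (one_sub_torusCos_le hd z θ)

theorem integrable_fejer_sum (z : Zd d) : Integrable
    (fun θ => (d : ℝ) ^ 2 * ∑ i, ‖geomKernel i 1 (z i).natAbs θ‖ ^ 2) (torusMeasure d) :=
  integrable_torus (continuous_const.mul (continuous_finsetSum _ fun _ _ =>
    ((continuous_geomKernel _ _ _).norm).pow 2))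

theorem integrable_kernelIntegrand (hd : 0 < d) (z : Zd d) :
    Integrable (kernelIntegrand z) (torusMeasure d) := by
  refine (integrable_fejer_sum z).mono' ?_ (ae_of_all _ fun θ => ?_)
  · exact ((measurable_const.sub (continuous_torusCos z).measurable).div
      (measurable_const.sub continuous_stepChar.measurable)).aestronglyMeasurable
  · rw [Real.norm_of_nonneg (kernelIntegrand_nonneg hd z θ)]
    exact kernelIntegrand_le hd z θ

theorem tendsto_expectedVisits_sub (hd : 0 < d) (z : Zd d) :
    Tendsto (fun n : ℕ => expectedVisits d n 0 - expectedVisits d n z) atTop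
      (𝓝 (∫ θ, kernelIntegrand z θ ∂torusMeasure d)) := by
  have hn : ∀ n : ℕ, expectedVisits d n 0 - expectedVisits d n z =
      ∫ θ, (1 - stepChar θ ^ (n + 1)) * kernelIntegrand z θ ∂torusMeasure d := by
    intro n
    have hc : ∀ (k : ℕ) (v : Zd d), Integrable (fun θ => stepChar θ ^ k * torusCos v θ)
        (torusMeasure d) := fun k v =>
      integrable_torus ((continuous_stepChar.pow k).mul (continuous_torusCos v))
    simp only [expectedVisits_eq_sum hd, transitionProb_eq_integral hd]
    rw [← Finset.sum_sub_distrib]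
    simp only [← integral_sub (hc _ _) (hc _ _)]
    rw [← integral_finsetSum _ fun k _ => by exact (hc _ _).sub (hc _ _)]
    refine integral_congr_ae ?_
    filter_upwards [ae_abs_stepChar_lt_one hd] with θ hθ
    have h1 : 1 - stepChar θ ≠ 0 := by linarith [le_abs_self (stepChar θ)]
    have h2 := geom_sum_mul (stepChar θ) (n + 1)
    simp only [torusCos_zero, ← mul_sub, ← Finset.sum_mul, kernelIntegrand]
    field_simp
    linear_combination (-(1 - torusCos z θ)) * h2
  simp only [hn]
  refine tendsto_integral_of_dominated_convergence (fun θ => 2 * kernelIntegrand z θ)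
    (fun n => ?_) ((integrable_kernelIntegrand hd z).const_mul 2) (fun n => ae_of_all _ fun θ => ?_)
    ?_
  · exact (continuous_const.sub (continuous_stepChar.pow _)).aestronglyMeasurable.mul
      (integrable_kernelIntegrand hd z).aestronglyMeasurable
  · rw [norm_mul, Real.norm_of_nonneg (kernelIntegrand_nonneg hd z θ)]
    refine mul_le_mul_of_nonneg_right ?_ (kernelIntegrand_nonneg hd z θ)
    have h := pow_le_one₀ (n := n + 1) (abs_nonneg _) (abs_stepChar_le θ hd)
    rw [← abs_pow] at h
    rw [Real.norm_eq_abs]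
    have h' := abs_le.1 h
    exact abs_le.2 ⟨by linarith, by linarith⟩
  · filter_upwards [ae_abs_stepChar_lt_one hd] with θ hθ
    have h := ((tendsto_pow_atTop_nhds_zero_of_abs_lt_one hθ).comp (tendsto_add_atTop_nat 1))
    simpa using (h.const_sub 1).mul_const (kernelIntegrand z θ)

theorem potentialKernel_eq_integral (hd : 0 < d) (z : Zd d) :
    potentialKernel d z = ∫ θ, kernelIntegrand z θ ∂torusMeasure d :=
  (tendsto_expectedVisits_sub hd z).limUnder_eq

theorem potentialKernel_nonneg (hd : 0 < d) (z : Zd d) : 0 ≤ potentialKernel d z := by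
  rw [potentialKernel_eq_integral hd]
  exact integral_nonneg fun θ => kernelIntegrand_nonneg hd z θ

/-- The potential kernel has at most linear growth, since the Fejér kernels that bound it have
mean `|z i|`. -/
theorem potentialKernel_le (hd : 0 < d) (z : Zd d) :
    potentialKernel d z ≤ d ^ 3 * ‖z‖ := by
  rw [potentialKernel_eq_integral hd]
  refine (integral_mono (integrable_kernelIntegrand hd z) (integrable_fejer_sum z)
    (kernelIntegrand_le hd z)).trans ?_
  rw [integral_const_mul, integral_finsetSum _ fun i _ => by
    exact integrable_torus (((continuous_geomKernel _ _ _).norm).pow 2)]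
  simp only [integral_sq_norm_geomKernel _ one_ne_zero]
  have h : ∀ i : Fin d, ((z i).natAbs : ℝ) ≤ ‖z‖ := by
    intro i
    refine le_trans (le_of_eq ?_) (norm_le_pi_norm z i)
    rw [Nat.cast_natAbs, Int.norm_eq_abs, Int.cast_abs]
  calc (d : ℝ) ^ 2 * ∑ i, ((z i).natAbs : ℝ) ≤ d ^ 2 * ∑ i : Fin d, ‖z‖ := by
        gcongr with i; exact h i
    _ = d ^ 3 * ‖z‖ := by simp; ring

theorem potentialKernel_neg (hd : 0 < d) (z : Zd d) :
    potentialKernel d (-z) = potentialKernel d z := by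
  simp only [potentialKernel_eq_integral hd, kernelIntegrand, torusCos_neg]

/-- The potential kernel is harmonic off the origin, where its Laplacian is `1`. -/
theorem latticeAvg_potentialKernel (hd : 0 < d) (z : Zd d) :
    latticeAvg (potentialKernel d) z = potentialKernel d z + if z = 0 then 1 else 0 := by
  have hd' : (d : ℝ) ≠ 0 := by exact_mod_cast hd.ne'
  rw [show potentialKernel d = _ from funext (potentialKernel_eq_integral hd),
    ← integral_latticeAvg _ _ (integrable_kernelIntegrand hd), ← integral_torusCos,
    ← integral_add (integrable_kernelIntegrand hd z) (integrable_torus (continuous_torusCos z))]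
  refine integral_congr_ae ?_
  filter_upwards [ae_abs_stepChar_lt_one hd] with θ hθ
  have h1 : 1 - stepChar θ ≠ 0 := by linarith [le_abs_self (stepChar θ)]
  have h2 : latticeAvg (fun v => kernelIntegrand v θ) z =
      (1 - latticeAvg (fun v => torusCos v θ) z) / (1 - stepChar θ) := by
    simp only [latticeAvg, kernelIntegrand, ← add_div, ← Finset.sum_div, sub_add_sub_comm,
      Finset.sum_sub_distrib]
    simp
    field_simp
    ring
  rw [h2, latticeAvg_torusCos, kernelIntegrand]
  field_simp
  ring

end Kernel

/-! ### Potentials of measures -/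

section Potential

variable {d : ℕ}

theorem hasPotential_of_integrable_norm (hd : 0 < d) {ν : Measure (Zd d)} [IsFiniteMeasure ν]
    (hν : Integrable (fun x => ‖x‖) ν) : HasPotential ν := by
  intro y
  refine (((integrable_const ‖y‖).add hν).const_mul ((d : ℝ) ^ 3)).mono'
    Measurable.of_discrete.aestronglyMeasurable (ae_of_all _ fun x => ?_)
  rw [Real.norm_of_nonneg (potentialKernel_nonneg hd _)]
  refine (potentialKernel_le hd _).trans ?_
  exact mul_le_mul_of_nonneg_left (norm_sub_le _ _) (by positivity)

/-- The potential of `ν` is superharmonic, with Laplacian `-ν`. -/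
theorem latticeAvg_potential (hd : 0 < d) {ν : Measure (Zd d)} [IsFiniteMeasure ν]
    (hν : HasPotential ν) (y : Zd d) :
    latticeAvg (potential ν) y = potential ν y - ν.real {y} := by
  have h1 : latticeAvg (potential ν) y =
      -latticeAvg (fun v => ∫ x, potentialKernel d (v - x) ∂ν) y := by
    simp only [latticeAvg, potential, ← neg_add, Finset.sum_neg_distrib, mul_neg]
  have h2 : ∀ x, latticeAvg (fun v => potentialKernel d (v - x)) y =
      potentialKernel d (y - x) + ({y} : Set (Zd d)).indicator 1 x := by
    intro x
    have h3 := latticeAvg_potentialKernel hd (y - x)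
    simp only [latticeAvg, add_sub_right_comm] at h3 ⊢
    rw [h3]
    simp [Set.indicator, sub_eq_zero, eq_comm]
  rw [h1, ← integral_latticeAvg ν (fun x v => potentialKernel d (v - x)) (fun v => hν v)]
  simp only [h2]
  rw [integral_add (g := ({y} : Set (Zd d)).indicator 1) (hν y)
      ((integrable_const (1 : ℝ)).indicator (measurableSet_singleton y)),
    integral_indicator_one (measurableSet_singleton y), potential]
  ring

theorem latticeAvg_potentialKernel_sub (hd : 0 < d) (y x : Zd d) :
    latticeAvg (fun v => potentialKernel d (y - v)) x =
      potentialKernel d (y - x) + if x = y then 1 else 0 := by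
  have h : ∀ v, potentialKernel d (y - v) = potentialKernel d (v - y) := fun v => by
    rw [← potentialKernel_neg hd, neg_sub]
  have h3 := latticeAvg_potentialKernel hd (x - y)
  simp only [h]
  simp only [latticeAvg, add_sub_right_comm] at h3 ⊢
  rw [h3]
  simp [sub_eq_zero]

theorem latticeAvg_coord (hd : 0 < d) (i : Fin d) (z : Zd d) :
    latticeAvg (fun v => (v i : ℝ)) z = z i := by
  have hd' : (d : ℝ) ≠ 0 := by exact_mod_cast hd.ne'
  have h : ∀ j : Fin d, (((z + Pi.single j 1 : Zd d) i : ℤ) : ℝ) +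
      (((z + Pi.single j (-1) : Zd d) i : ℤ) : ℝ) =
      2 * z i := by
    intro j
    simp only [Pi.single_neg, Pi.add_apply, Pi.neg_apply]
    push_cast
    ring
  simp only [latticeAvg, h]
  simp
  field_simp

end Potential

/-! ### The walk stopped at a stopping time -/

section

variable {d : ℕ} {Ω : Type*} {X : ℕ → Ω → Zd d}

theorem add_one_le_of_coe_lt {t : ℕ} {a : WithTop ℕ} (h : (t : WithTop ℕ) < a) :
    ((t + 1 : ℕ) : WithTop ℕ) ≤ a := by
  induction a using WithTop.recTopCoe with
  | top => exact le_top
  | coe n => exact WithTop.coe_le_coe.2 (WithTop.coe_lt_coe.1 h)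

theorem stoppedProcess_eq_self {τ : Ω → WithTop ℕ} {t : ℕ} {ω : Ω} (h : (t : WithTop ℕ) < τ ω) :
    stoppedProcess X τ t ω = X t ω :=
  stoppedProcess_eq_of_le h.le

theorem stoppedProcess_succ_of_lt {τ : Ω → WithTop ℕ} {t : ℕ} {ω : Ω}
    (h : (t : WithTop ℕ) < τ ω) : stoppedProcess X τ (t + 1) ω = X (t + 1) ω :=
  stoppedProcess_eq_of_le (add_one_le_of_coe_lt h)

theorem stoppedProcess_of_le {τ : Ω → WithTop ℕ} {t : ℕ} {ω : Ω}
    (h : τ ω ≤ (t : WithTop ℕ)) : stoppedProcess X τ t ω = stoppedValue X τ ω :=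
  stoppedProcess_eq_of_ge h

theorem stoppedProcess_succ_of_le {τ : Ω → WithTop ℕ} {t : ℕ} {ω : Ω}
    (h : τ ω ≤ (t : WithTop ℕ)) : stoppedProcess X τ (t + 1) ω = stoppedProcess X τ t ω := by
  rw [stoppedProcess_of_le h, stoppedProcess_of_le (h.trans (by exact_mod_cast t.le_succ))]

end

section Stopped

variable {d : ℕ} {Ω : Type*} [MeasurableSpace Ω] {P : Measure Ω} {X : ℕ → Ω → Zd d}

theorem IsSSRW.measurable_natural (hX : IsSSRW P X) {s t : ℕ} (hst : s ≤ t) :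
    Measurable[Filtration.natural X hX.stronglyMeasurable t] (X s) :=
  measurable_iff_comap_le.2 (le_iSup₂_of_le (f := fun j (_ : j ≤ t) =>
    MeasurableSpace.comap (X j) _) s hst le_rfl)

theorem IsSSRW.measurable_stoppedProcess (hX : IsSSRW P X) {τ : Ω → WithTop ℕ}
    (hτ : IsStoppingTime (Filtration.natural X hX.stronglyMeasurable) τ) (t : ℕ) :
    Measurable[Filtration.natural X hX.stronglyMeasurable t] (stoppedProcess X τ t) := by
  induction t with
  | zero =>
    have : stoppedProcess X τ 0 = X 0 := by
      ext ω : 1; exact stoppedProcess_eq_of_le (by simp)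
    rw [this]
    exact hX.measurable_natural le_rfl
  | succ t ih =>
    classical
    have h : stoppedProcess X τ (t + 1) =
        {ω | τ ω ≤ (t : WithTop ℕ)}.piecewise (stoppedProcess X τ t) (X (t + 1)) := by
      ext ω : 1
      by_cases h : τ ω ≤ (t : WithTop ℕ)
      · rw [Set.piecewise_eq_of_mem _ _ _ (by exact h), stoppedProcess_succ_of_le h]
      · rw [Set.piecewise_eq_of_notMem _ _ _ (by exact h),
          stoppedProcess_succ_of_lt (not_le.1 h)]
    have hm := (Filtration.natural X hX.stronglyMeasurable).mono t.le_succ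
    rw [h]
    exact Measurable.piecewise (hm _ (hτ t)) (ih.mono hm le_rfl) (hX.measurable_natural le_rfl)

theorem integrable_comp_of_linear_growth [IsFiniteMeasure P] {Z : Ω → Zd d} (hZ : Integrable Z P)
    (hZm : Measurable Z) {f : Zd d → ℝ} {C : ℝ} (hf : ∀ x, |f x| ≤ C * (1 + ‖x‖)) (v : Zd d) :
    Integrable (fun ω => f (Z ω + v)) P := by
  have hC : 0 ≤ C := by simpa using (abs_nonneg _).trans (hf 0)
  refine (((integrable_const (1 : ℝ)).add (hZ.norm.add (integrable_const ‖v‖))).const_mul C).mono'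
    ((Measurable.of_discrete (f := fun x => f (x + v))).comp hZm).aestronglyMeasurable
    (ae_of_all _ fun ω => (hf _).trans ?_)
  exact mul_le_mul_of_nonneg_left (add_le_add le_rfl (norm_add_le _ _)) hC

/-- Dynkin's formula over one time step of the stopped walk. -/
theorem IsSSRW.setIntegral_stoppedProcess_succ [IsProbabilityMeasure P] (hd : 0 < d)
    (hX : IsSSRW P X) {τ : Ω → WithTop ℕ}
    (hτ : IsStoppingTime (Filtration.natural X hX.stronglyMeasurable) τ)
    (hZ : ∀ t, Integrable (stoppedProcess X τ t) P)
    {f : Zd d → ℝ} {C : ℝ} (hf : ∀ x, |f x| ≤ C * (1 + ‖x‖)) (t : ℕ) {B : Set Ω}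
    (hB : MeasurableSet[Filtration.natural X hX.stronglyMeasurable t] B) :
    ∫ ω in B, f (stoppedProcess X τ (t + 1) ω) ∂P = ∫ ω in B, f (stoppedProcess X τ t ω) ∂P +
      ∫ ω in B ∩ {ω | (t : WithTop ℕ) < τ ω}, (latticeAvg f (X t ω) - f (X t ω)) ∂P := by
  set F := Filtration.natural X hX.stronglyMeasurable with hF
  have hS : MeasurableSet[F t] {ω | (t : WithTop ℕ) < τ ω} := hτ.measurableSet_gt t
  have hS' := F.le t _ hS
  have hB' := F.le t _ hB
  have hBS := hB.inter hS
  have hZm : ∀ s, Measurable (stoppedProcess X τ s) := fun s =>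
    (hX.measurable_stoppedProcess hτ s).mono (F.le s) le_rfl
  have hI : ∀ v, IntegrableOn (fun ω => f (X t ω + v)) (B ∩ {ω | (t : WithTop ℕ) < τ ω}) P := by
    intro v
    refine (integrable_comp_of_linear_growth (hZ t) (hZm t) hf v).integrableOn.congr_fun
      (fun ω hω => ?_) (F.le t _ hBS)
    have hω' : (t : WithTop ℕ) < τ ω := hω.2
    simp only [stoppedProcess_eq_self hω']
  have hIZ : ∀ s, Integrable (fun ω => f (stoppedProcess X τ s ω)) P := fun s => by
    simpa using integrable_comp_of_linear_growth (hZ s) (hZm s) hf 0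
  have hI0 : IntegrableOn (fun ω => f (X t ω)) (B ∩ {ω | (t : WithTop ℕ) < τ ω}) P := by
    simpa using hI 0
  have hIavg : IntegrableOn (fun ω => latticeAvg f (X t ω))
      (B ∩ {ω | (t : WithTop ℕ) < τ ω}) P :=
    (integrable_finsetSum _ fun i _ => by exact (hI _).add (hI _)).const_mul _
  have hM := hX.setIntegral_succ hd t hBS f fun i => ⟨hI _, hI _⟩
  have hdiff : ∀ ω, f (stoppedProcess X τ (t + 1) ω) - f (stoppedProcess X τ t ω) =
      {ω | (t : WithTop ℕ) < τ ω}.indicator (fun ω => f (X (t + 1) ω) - f (X t ω)) ω := by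
    intro ω
    by_cases h : (t : WithTop ℕ) < τ ω
    · rw [Set.indicator_of_mem (by exact h), stoppedProcess_succ_of_lt h, stoppedProcess_eq_self h]
    · rw [Set.indicator_of_notMem (by exact h), stoppedProcess_succ_of_le (not_lt.1 h), sub_self]
  rw [← sub_eq_iff_eq_add', ← integral_sub (hIZ _).integrableOn (hIZ _).integrableOn]
  simp only [hdiff]
  rw [setIntegral_indicator hS', integral_sub hM.1 hI0, hM.2, integral_sub hIavg hI0]

end Stopped

/-! ### Exit times -/

section Exit

variable {d : ℕ} {Ω : Type*} {X : ℕ → Ω → Zd d} {D : Set (ℤ × Zd d)}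

theorem lt_exitTime_iff {t : ℕ} {ω : Ω} :
    (t : WithTop ℕ) < exitTime D X ω ↔ ∀ s ≤ t, ((s : ℤ), X s ω) ∈ D := by
  have h := hittingAfter_le_iff (u := fun (t : ℕ) ω => ((t : ℤ), X t ω)) (s := Dᶜ) (n := 0)
    (i := t) (ω := ω)
  refine (not_le.symm.trans (not_congr h)).trans ?_
  simp

theorem notMem_of_exitTime_eq {t : ℕ} {ω : Ω} (h : exitTime D X ω = t) :
    ((t : ℤ), X t ω) ∉ D := by
  have h1 : exitTime D X ω ≠ ⊤ := by simp [h]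
  have h2 := hittingAfter_mem_set_of_ne_top h1
  change ((((exitTime D X ω).untopA : ℕ) : ℤ), X (exitTime D X ω).untopA ω) ∈ Dᶜ at h2
  rw [h] at h2
  exact h2

theorem exitTime_truncate (T : ℕ) (ω : Ω) :
    exitTime (truncate D T) X ω = min (T : WithTop ℕ) (exitTime D X ω) := by
  refine eq_of_forall_lt_iff fun c => ?_
  induction c using WithTop.recTopCoe with
  | top => simp
  | coe t =>
    change ((t : ℕ) : WithTop ℕ) < _ ↔ ((t : ℕ) : WithTop ℕ) < _
    rw [lt_min_iff, lt_exitTime_iff, lt_exitTime_iff]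
    simp only [truncate, Set.mem_inter_iff, Set.mem_prod, Set.mem_Ico, Set.mem_univ, and_true,
      Nat.cast_lt, Nat.cast_nonneg, true_and]
    exact ⟨fun h => ⟨(h t le_rfl).2, fun s hs => (h s hs).1⟩,
      fun h s hs => ⟨h.2 s hs, lt_of_le_of_lt hs h.1⟩⟩

theorem exitLaw_truncate [MeasurableSpace Ω] (P : Measure Ω) (T : ℕ) :
    exitLaw P X (truncate D T) = P.map (stoppedProcess X (exitTime D X) T) := by
  have h : exitTime (truncate D T) X = fun ω => min (T : WithTop ℕ) (exitTime D X ω) :=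
    funext (exitTime_truncate T)
  rw [exitLaw, h]
  rfl

theorem isStoppingTime_exitTime [MeasurableSpace Ω] {P : Measure Ω} (hX : IsSSRW P X)
    (D : Set (ℤ × Zd d)) :
    IsStoppingTime (Filtration.natural X hX.stronglyMeasurable) (exitTime D X) := by
  intro t
  have h : {ω | exitTime D X ω ≤ (t : WithTop ℕ)} =
      ⋃ s ∈ Set.Iic t, X s ⁻¹' {v | ((s : ℤ), v) ∉ D} := by
    ext ω
    rw [Set.mem_ofPred_eq, ← not_lt, lt_exitTime_iff]
    simp
  change MeasurableSet[Filtration.natural X hX.stronglyMeasurable t]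
    {ω | exitTime D X ω ≤ (t : WithTop ℕ)}
  rw [h]
  exact MeasurableSet.biUnion (Set.to_countable _) fun s hs =>
    hX.measurable_natural hs (MeasurableSet.of_discrete)

/-- If the stopped walk is bounded in `L¹`, then the walk leaves `D`: the coordinates of the
stopped walk are martingales and converge, whereas a walk that is never stopped moves by a unit
vector in every step. -/
theorem IsSSRW.ae_exitTime_lt_top [MeasurableSpace Ω] {P : Measure Ω} [IsProbabilityMeasure P]
    (hd : 0 < d) (hX : IsSSRW P X)
    (hUI : UniformIntegrable (stoppedProcess X (exitTime D X)) 1 P) :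
    ∀ᵐ ω ∂P, exitTime D X ω < ⊤ := by
  set Z := stoppedProcess X (exitTime D X) with hZdef
  have hτ := isStoppingTime_exitTime hX D
  have hZ : ∀ t, Integrable (Z t) P := fun t => memLp_one_iff_integrable.1 (hUI.memLp t)
  obtain ⟨R, hR⟩ := hUI.2.2
  have hle : ∀ (i : Fin d) (x : Zd d), |(x i : ℝ)| ≤ ‖x‖ := fun i x => by
    have := norm_le_pi_norm x i
    rwa [Int.norm_eq_abs] at this
  have hconv : ∀ i : Fin d, ∀ᵐ ω ∂P, ∃ c, Tendsto (fun t => (Z t ω i : ℝ)) atTop (𝓝 c) := by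
    intro i
    have hf : ∀ x : Zd d, |(x i : ℝ)| ≤ 1 * (1 + ‖x‖) := fun x => by linarith [hle i x]
    have hsub : Submartingale (fun t ω => (Z t ω i : ℝ))
        (Filtration.natural X hX.stronglyMeasurable) P := by
      refine submartingale_of_setIntegral_le_succ (fun t => ?_) (fun t => ?_) fun t s hs => ?_
      · exact ((Measurable.of_discrete (f := fun x : Zd d => (x i : ℝ))).comp
          (hX.measurable_stoppedProcess hτ t)).stronglyMeasurable
      · simpa using integrable_comp_of_linear_growth (hZ t)
          ((hX.measurable_stoppedProcess hτ t).mono (Filtration.le _ t) le_rfl) hf 0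
      · rw [hX.setIntegral_stoppedProcess_succ hd hτ hZ hf t hs]
        simp [latticeAvg_coord hd, hZdef]
    refine hsub.exists_ae_tendsto_of_bdd (R := R) fun t => le_trans ?_ (hR t)
    exact eLpNorm_mono fun ω => by simpa using hle i (Z t ω)
  have hstep : ∀ t, ∀ᵐ ω ∂P, X (t + 1) ω - X t ω ≠ 0 := fun t =>
    hX.ae_step t (p := fun u => u ≠ 0) fun i => by simp
  filter_upwards [ae_all_iff.2 hconv, ae_all_iff.2 hstep] with ω hω hω'
  rw [lt_top_iff_ne_top]
  intro htop
  have hZX : ∀ t, Z t ω = X t ω := fun t => stoppedProcess_eq_of_le (by simp [htop])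
  have hev : ∀ i : Fin d, ∀ᶠ t in atTop, X (t + 1) ω i = X t ω i := by
    intro i
    obtain ⟨c, hc⟩ := hω i
    simp only [hZX] at hc
    have h0 := (hc.comp (tendsto_add_atTop_nat 1)).sub hc
    rw [sub_self] at h0
    filter_upwards [h0.abs.eventually (gt_mem_nhds (by simp : |(0 : ℝ)| < 1))] with t ht
    simp only [Function.comp_apply] at ht
    rw [← sub_eq_zero, ← Int.abs_lt_one_iff]
    exact_mod_cast ht
  obtain ⟨t, ht⟩ := (eventually_all.2 hev).exists
  exact hω' t (by ext i; simp [ht i])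

theorem unifIntegrable_of_linear_growth [MeasurableSpace Ω] {P : Measure Ω} [IsFiniteMeasure P]
    {Z : ℕ → Ω → Zd d} (hZ : UnifIntegrable Z 1 P) {f : Zd d → ℝ} {C : ℝ}
    (hf : ∀ x, |f x| ≤ C * (1 + ‖x‖)) (hm : ∀ t, Measurable (Z t)) :
    UnifIntegrable (fun t ω => f (Z t ω)) 1 P := by
  have hC : 0 ≤ C := by simpa using (abs_nonneg _).trans (hf 0)
  have h1 : UnifIntegrable (fun (_ : ℕ) (_ : Ω) => C) 1 P :=
    unifIntegrable_const le_rfl (by simp) (memLp_const C)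
  have h2 : UnifIntegrable (fun t ω => C * ‖Z t ω‖) 1 P := by
    intro ε hε
    obtain ⟨δ, hδ, h⟩ := hZ (ε := ε / (C + 1)) (by positivity)
    refine ⟨δ, hδ, fun t s hs hsδ => ?_⟩
    have h3 : s.indicator (fun ω => C * ‖Z t ω‖) = C • s.indicator (fun ω => ‖Z t ω‖) := by
      ext ω
      by_cases hω : ω ∈ s <;> simp [hω]
    have h4 : eLpNorm (s.indicator fun ω => ‖Z t ω‖) 1 P = eLpNorm (s.indicator (Z t)) 1 P := by
      refine eLpNorm_congr_norm_ae (ae_of_all _ fun ω => ?_)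
      by_cases hω : ω ∈ s <;> simp [hω]
    rw [h3, eLpNorm_const_smul, h4, Real.enorm_eq_ofReal hC]
    calc ENNReal.ofReal C * eLpNorm (s.indicator (Z t)) 1 P
        ≤ ENNReal.ofReal C * ENNReal.ofReal (ε / (C + 1)) := by gcongr; exact h t s hs hsδ
      _ = ENNReal.ofReal (C * (ε / (C + 1))) := (ENNReal.ofReal_mul hC).symm
      _ ≤ ENNReal.ofReal ε := by
        refine ENNReal.ofReal_le_ofReal ?_
        rw [mul_div_assoc', div_le_iff₀ (by positivity)]
        nlinarith
  have h3 := h1.add h2 le_rfl (fun _ => aestronglyMeasurable_const) fun t =>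
    ((hm t).norm.const_mul C).aestronglyMeasurable
  intro ε hε
  obtain ⟨δ, hδ, h⟩ := h3 hε
  refine ⟨δ, hδ, fun t s hs hsδ => le_trans (eLpNorm_mono fun ω => ?_) (h t s hs hsδ)⟩
  by_cases hω : ω ∈ s
  · simp only [hω, Set.indicator_of_mem, Pi.add_apply, Real.norm_eq_abs]
    refine (hf _).trans (le_trans (le_of_eq ?_) (le_abs_self _))
    ring
  · simp [hω]

end Exit

/-! ### The reversed exit time -/

section

variable {d : ℕ} {Ω : Type*} {Y : ℕ → Ω → Zd d}

theorem lt_reversedExitTime_iff {D : Set (ℤ × Zd d)} {T t : ℕ} {ω : Ω} :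
    (t : WithTop ℕ) < reversedExitTime D T Y ω ↔
      (∀ s ≤ t, ((T : ℤ) - s, Y s ω) ∈ D) ∧ t < T := by
  have h := hittingAfter_le_iff (u := fun (t : ℕ) ω => ((T : ℤ) - (t : ℤ), Y t ω)) (s := Dᶜ)
    (n := 0) (i := t) (ω := ω)
  rw [reversedExitTime, lt_min_iff]
  refine and_congr ((not_le.symm.trans (not_congr h)).trans ?_) (by simp)
  simp

theorem notMem_of_reversedExitTime_eq {D : Set (ℤ × Zd d)} {T t : ℕ} {ω : Ω} (htT : t < T)
    (h : reversedExitTime D T Y ω = (t : WithTop ℕ)) : ((T : ℤ) - t, Y t ω) ∉ D := by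
  intro hmem
  refine (lt_irrefl (t : WithTop ℕ)) ?_
  conv_rhs => rw [← h]
  refine lt_reversedExitTime_iff.2 ⟨fun s hs => ?_, htT⟩
  rcases hs.eq_or_lt with rfl | hs
  · exact hmem
  · refine (lt_reversedExitTime_iff.1 (?_ : (s : WithTop ℕ) < reversedExitTime D T Y ω)).1 s le_rfl
    rw [h]
    exact WithTop.coe_lt_coe.2 hs

end

theorem le_natCast_cases {a : WithTop ℕ} {T : ℕ} (h : a ≤ (T : WithTop ℕ)) :
    ∃ t ≤ T, a = (t : WithTop ℕ) := by
  induction a using WithTop.recTopCoe with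
  | top => exact absurd h (by simp)
  | coe n => exact ⟨n, WithTop.coe_le_coe.1 h, rfl⟩

/-! ### Optimal stopping of the walk before a deterministic time -/

section OptimalStopping

variable {d : ℕ} {Ω : Type*} [MeasurableSpace Ω] {P : Measure Ω} {Y : ℕ → Ω → Zd d}

/-- A walk with a deterministic start takes finitely many values at each time, so that every
function of its position is integrable. -/
theorem IsSSRW.integrable_comp [IsProbabilityMeasure P] (hd : 0 < d) (hY : IsSSRW P Y) {y : Zd d}
    (hY0 : ∀ᵐ ω ∂P, Y 0 ω = y) (f : Zd d → ℝ) (t : ℕ) : Integrable (fun ω => f (Y t ω)) P := by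
  induction t generalizing f with
  | zero =>
    have h : Integrable (fun _ : Ω => f y) P := integrable_const _
    refine h.congr ?_
    filter_upwards [hY0] with ω hω
    rw [hω]
  | succ t ih =>
    have h := (hY.setIntegral_succ hd t MeasurableSet.univ f fun i =>
      ⟨(ih fun v => f (v + (Pi.single i 1 : Zd d))).integrableOn,
        (ih fun v => f (v + (Pi.single i (-1) : Zd d))).integrableOn⟩).1
    rwa [integrableOn_univ] at h

theorem IsStoppingTime.measurableSet_coe_le {F : Filtration ℕ ‹MeasurableSpace Ω›}
    {τ : Ω → WithTop ℕ} (hτ : IsStoppingTime F τ) (t : ℕ) :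
    MeasurableSet {ω | (t : WithTop ℕ) ≤ τ ω} :=
  F.le t _ (hτ.measurableSet_ge t)

theorem IsStoppingTime.measurableSet_eq_coe {F : Filtration ℕ ‹MeasurableSpace Ω›}
    {τ : Ω → WithTop ℕ} (hτ : IsStoppingTime F τ) (t : ℕ) :
    MeasurableSet {ω | τ ω = (t : WithTop ℕ)} :=
  F.le t _ (hτ.measurableSet_eq t)

/-- A reward that is a function of the time and of the position at a bounded stopping time is
integrable. -/
theorem IsSSRW.integrable_reward [IsProbabilityMeasure P] (hd : 0 < d) (hY : IsSSRW P Y)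
    {y : Zd d} (hY0 : ∀ᵐ ω ∂P, Y 0 ω = y) {T : ℕ} {τ : Ω → WithTop ℕ}
    (hτ : τ ∈ stoppingTimesUpTo Y hY.stronglyMeasurable T) {G : ℕ → Zd d → ℝ} {R : Ω → ℝ}
    (hR : ∀ ω (t : ℕ), τ ω = (t : WithTop ℕ) → R ω = G (T - t) (Y t ω)) : Integrable R P := by
  have h : R = fun ω => ∑ t ∈ Finset.range (T + 1),
      {ω | τ ω = (t : WithTop ℕ)}.indicator (fun ω => G (T - t) (Y t ω)) ω := by
    ext ω
    obtain ⟨t, ht, hτt⟩ := le_natCast_cases (hτ.2 ω)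
    rw [Finset.sum_eq_single t]
    · rw [Set.indicator_of_mem (by exact hτt), hR ω t hτt]
    · intro s _ hs
      refine Set.indicator_of_notMem (fun hmem => hs ?_) _
      have : ((s : ℕ) : WithTop ℕ) = (t : WithTop ℕ) := by rw [← hτt]; exact hmem.symm
      exact WithTop.coe_injective this
    · intro h; simp at h; omega
  rw [h]
  exact integrable_finsetSum _ fun t _ => (hY.integrable_comp hd hY0 _ t).indicator
    (IsStoppingTime.measurableSet_eq_coe hτ.1 t)

/-- If, along the stopped walk, `V` is superharmonic in space-time and dominates the payoff `G`
where the walk stops, then the expected payoff is at most the initial value of `V`. The first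
argument of `V` and `G` is the remaining time. -/
theorem IsSSRW.integral_reward_le [IsProbabilityMeasure P] (hd : 0 < d) (hY : IsSSRW P Y)
    {y : Zd d} (hY0 : ∀ᵐ ω ∂P, Y 0 ω = y) {T : ℕ} {τ : Ω → WithTop ℕ}
    (hτ : τ ∈ stoppingTimesUpTo Y hY.stronglyMeasurable T) {V G : ℕ → Zd d → ℝ} {R : Ω → ℝ}
    (hR : ∀ ω (t : ℕ), τ ω = (t : WithTop ℕ) → R ω = G (T - t) (Y t ω))
    (hpay : ∀ ω (n t : ℕ), n + t = T → τ ω = (t : WithTop ℕ) → G n (Y t ω) ≤ V n (Y t ω))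
    (hcont : ∀ ω (n t : ℕ), n + 1 + t = T → (t : WithTop ℕ) < τ ω →
      latticeAvg (V n) (Y t ω) ≤ V (n + 1) (Y t ω)) :
    ∫ ω, R ω ∂P ≤ V T y := by
  have hRint := hY.integrable_reward hd hY0 hτ hR
  have hVint := fun (n t : ℕ) => hY.integrable_comp hd hY0 (V n) t
  -- backward induction in time: `n` is the time that remains
  have key : ∀ n t : ℕ, n + t = T → ∫ ω in {ω | (t : WithTop ℕ) ≤ τ ω}, R ω ∂P ≤
      ∫ ω in {ω | (t : WithTop ℕ) ≤ τ ω}, V n (Y t ω) ∂P := by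
    intro n
    induction n with
    | zero =>
      intro t ht
      obtain rfl : t = T := by omega
      refine setIntegral_mono_on hRint.integrableOn (hVint 0 t).integrableOn
        (IsStoppingTime.measurableSet_coe_le hτ.1 t) fun ω hω => ?_
      have h : τ ω = (t : WithTop ℕ) := le_antisymm (hτ.2 ω) hω
      rw [hR ω t h, Nat.sub_self]
      exact hpay ω 0 t ht h
    | succ n ih =>
      intro t ht
      have hsplit : {ω | (t : WithTop ℕ) ≤ τ ω} =
          {ω | τ ω = (t : WithTop ℕ)} ∪ {ω | (t : WithTop ℕ) < τ ω} := by
        ext ω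
        simp only [Set.mem_ofPred_eq, Set.mem_union]
        rw [le_iff_lt_or_eq, or_comm, eq_comm]
      have hgt : {ω | (t : WithTop ℕ) < τ ω} = {ω | ((t + 1 : ℕ) : WithTop ℕ) ≤ τ ω} := by
        ext ω
        have hlt : (t : WithTop ℕ) < ((t + 1 : ℕ) : WithTop ℕ) :=
          WithTop.coe_lt_coe.2 t.lt_succ_self
        exact ⟨fun h => add_one_le_of_coe_lt h, fun h => hlt.trans_le h⟩
      have hdisj : Disjoint {ω | τ ω = (t : WithTop ℕ)} {ω | (t : WithTop ℕ) < τ ω} :=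
        Set.disjoint_left.2 fun ω h1 h2 => ne_of_gt h2 h1
      have hm := IsStoppingTime.measurableSet_coe_le hτ.1 (t + 1)
      rw [← hgt] at hm
      have hmF : MeasurableSet[Filtration.natural Y hY.stronglyMeasurable t]
          {ω | (t : WithTop ℕ) < τ ω} := hτ.1.measurableSet_gt t
      rw [hsplit, setIntegral_union hdisj hm hRint.integrableOn hRint.integrableOn,
        setIntegral_union hdisj hm (hVint _ _).integrableOn (hVint _ _).integrableOn]
      refine add_le_add ?_ ?_
      · refine setIntegral_mono_on hRint.integrableOn (hVint _ _).integrableOn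
          (IsStoppingTime.measurableSet_eq_coe hτ.1 t) fun ω hω => ?_
        have h : τ ω = (t : WithTop ℕ) := hω
        rw [hR ω t h, show T - t = n + 1 by omega]
        exact hpay ω (n + 1) t ht h
      · have h1 := ih (t + 1) (by omega)
        rw [← hgt] at h1
        refine h1.trans ?_
        rw [(hY.setIntegral_succ hd t hmF (V n) fun i =>
          ⟨(hY.integrable_comp hd hY0 (fun v => V n (v + (Pi.single i 1 : Zd d))) t).integrableOn,
            (hY.integrable_comp hd hY0
              (fun v => V n (v + (Pi.single i (-1) : Zd d))) t).integrableOn⟩).2]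
        exact setIntegral_mono_on (hY.integrable_comp hd hY0 (latticeAvg (V n)) t).integrableOn
          (hVint _ _).integrableOn hm fun ω hω => hcont ω n t ht hω
  have h0 := key T 0 (by simp)
  have huniv : {ω | ((0 : ℕ) : WithTop ℕ) ≤ τ ω} = Set.univ := Set.eq_univ_of_forall fun ω => by
    simp
  rw [huniv, setIntegral_univ, setIntegral_univ] at h0
  have hstart : (fun ω => V T (Y 0 ω)) =ᵐ[P] fun _ => V T y := by
    filter_upwards [hY0] with ω hω
    rw [hω]
  rw [integral_congr_ae hstart] at h0
  simpa using h0

theorem reversedExitTime_mem (hY : IsSSRW P Y) (D : Set (ℤ × Zd d)) (T : ℕ) :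
    reversedExitTime D T Y ∈ stoppingTimesUpTo Y hY.stronglyMeasurable T := by
  refine ⟨fun t => ?_, fun ω => min_le_right _ _⟩
  change MeasurableSet[Filtration.natural Y hY.stronglyMeasurable t]
    {ω | reversedExitTime D T Y ω ≤ (t : WithTop ℕ)}
  by_cases htT : t < T
  · have h : {ω | reversedExitTime D T Y ω ≤ (t : WithTop ℕ)} =
        ⋃ s ∈ Set.Iic t, Y s ⁻¹' {v | ((T : ℤ) - s, v) ∉ D} := by
      ext ω
      rw [Set.mem_ofPred_eq, ← not_lt, lt_reversedExitTime_iff]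
      simp [htT]
    rw [h]
    exact MeasurableSet.biUnion (Set.to_countable _) fun s hs =>
      hY.measurable_natural hs (MeasurableSet.of_discrete)
  · have h : {ω | reversedExitTime D T Y ω ≤ (t : WithTop ℕ)} = Set.univ := by
      refine Set.eq_univ_of_forall fun ω => ?_
      rw [Set.mem_ofPred_eq, ← not_lt, lt_reversedExitTime_iff]
      simp [htT]
    rw [h]
    exact MeasurableSet.univ

/-- Verification theorem: a function `V` that dominates the payoff `G`, is superharmonic in
space-time, harmonic in `D` and equal to `G` off `D` and at the terminal time, is the value of
the stopping problem, and the exit time of the time-reversed walk from `D` is optimal. -/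
theorem IsSSRW.optimal_stopping [IsProbabilityMeasure P] (hd : 0 < d) (hY : IsSSRW P Y)
    {y : Zd d} (hY0 : ∀ᵐ ω ∂P, Y 0 ω = y) {T : ℕ} {D : Set (ℤ × Zd d)} {V G : ℕ → Zd d → ℝ}
    {R : (Ω → WithTop ℕ) → Ω → ℝ}
    (hR : ∀ τ ω (t : ℕ), t ≤ T → τ ω = (t : WithTop ℕ) → R τ ω = G (T - t) (Y t ω))
    (hGV : ∀ n v, G n v ≤ V n v) (h0 : ∀ v, G 0 v = V 0 v)
    (hsuper : ∀ n v, latticeAvg (V n) v ≤ V (n + 1) v)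
    (hharm : ∀ (n : ℕ) v, ((n : ℤ) + 1, v) ∈ D → V (n + 1) v ≤ latticeAvg (V n) v)
    (hoff : ∀ (n : ℕ) v, ((n : ℤ) + 1, v) ∉ D → V (n + 1) v ≤ G (n + 1) v) :
    (∀ τ ∈ stoppingTimesUpTo Y hY.stronglyMeasurable T, Integrable (R τ) P) ∧
      reversedExitTime D T Y ∈ stoppingTimesUpTo Y hY.stronglyMeasurable T ∧
      V T y = ∫ ω, R (reversedExitTime D T Y) ω ∂P ∧
      IsLUB ((fun τ => ∫ ω, R τ ω ∂P) '' stoppingTimesUpTo Y hY.stronglyMeasurable T) (V T y) := by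
  have hR' : ∀ τ ∈ stoppingTimesUpTo Y hY.stronglyMeasurable T, ∀ ω (t : ℕ),
      τ ω = (t : WithTop ℕ) → R τ ω = G (T - t) (Y t ω) := by
    intro τ hτ ω t ht
    refine hR τ ω t ?_ ht
    have := hτ.2 ω
    rw [ht] at this
    exact WithTop.coe_le_coe.1 this
  have hle : ∀ τ ∈ stoppingTimesUpTo Y hY.stronglyMeasurable T, ∫ ω, R τ ω ∂P ≤ V T y :=
    fun τ hτ => hY.integral_reward_le hd hY0 hτ (hR' τ hτ) (fun _ _ _ _ _ => hGV _ _)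
      fun _ _ _ _ _ => hsuper _ _
  have hrev := reversedExitTime_mem hY D T
  -- for the exit time, the upper bound also applies to `-V` and `-G`
  have hge : V T y ≤ ∫ ω, R (reversedExitTime D T Y) ω ∂P := by
    have h := hY.integral_reward_le hd hY0 hrev (V := fun n v => -V n v) (G := fun n v => -G n v)
      (R := fun ω => -R (reversedExitTime D T Y) ω)
      (fun ω t ht => by rw [hR' _ hrev ω t ht]) (fun ω n t hnt ht => ?_) fun ω n t hnt ht => ?_
    · rw [integral_neg] at h
      linarith
    · rcases n with _ | n
      · rw [h0]
      · have hoffD := notMem_of_reversedExitTime_eq (by omega) ht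
        rw [show (T : ℤ) - t = (n : ℤ) + 1 by rw [← hnt]; push_cast; ring] at hoffD
        exact neg_le_neg (hoff n _ hoffD)
    · have hmem := (lt_reversedExitTime_iff.1 ht).1 t le_rfl
      rw [show (T : ℤ) - t = (n : ℤ) + 1 by rw [← hnt]; push_cast; ring] at hmem
      have h1 : latticeAvg (fun v => -V n v) (Y t ω) = -latticeAvg (V n) (Y t ω) := by
        simp only [latticeAvg, ← neg_add, Finset.sum_neg_distrib, mul_neg]
      rw [h1]
      exact neg_le_neg (hharm n _ hmem)
  refine ⟨fun τ hτ => hY.integrable_reward hd hY0 hτ (hR' τ hτ), hrev,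
    le_antisymm hge (hle _ hrev), ?_, ?_⟩
  · rintro _ ⟨τ, hτ, rfl⟩
    exact hle τ hτ
  · exact fun b hb => hge.trans (hb ⟨_, hrev, rfl⟩)

end OptimalStopping

/-! ### Potentials of the stopped walk -/

section Flow

variable {d : ℕ} {Ω : Type*} [MeasurableSpace Ω] {P : Measure Ω} {X : ℕ → Ω → Zd d}

/-- The potential of the law of `X` stopped at time `t` or upon leaving `D`. -/
def stoppedPotential (P : Measure Ω) (X : ℕ → Ω → Zd d) (D : Set (ℤ × Zd d)) (t : ℕ) :
    Zd d → ℝ :=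
  potential (P.map (stoppedProcess X (exitTime D X) t))

/-- The probability that `X` is at `v` at time `t` and has not yet left `D`. -/
def aliveProb (P : Measure Ω) (X : ℕ → Ω → Zd d) (D : Set (ℤ × Zd d)) (t : ℕ) (v : Zd d) : ℝ :=
  P.real {ω | (t : WithTop ℕ) < exitTime D X ω ∧ X t ω = v}

/-- The probability that `X` leaves `D` at `v` and not after time `t`. -/
def exitedProb (P : Measure Ω) (X : ℕ → Ω → Zd d) (D : Set (ℤ × Zd d)) (t : ℕ) (v : Zd d) : ℝ :=
  P.real {ω | exitTime D X ω ≤ (t : WithTop ℕ) ∧ stoppedValue X (exitTime D X) ω = v}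

variable {D : Set (ℤ × Zd d)}

theorem IsSSRW.measurable_stoppedProcess_exitTime (hX : IsSSRW P X) (t : ℕ) :
    Measurable (stoppedProcess X (exitTime D X) t) :=
  (hX.measurable_stoppedProcess (isStoppingTime_exitTime hX D) t).mono (Filtration.le _ t) le_rfl

theorem IsSSRW.measurableSet_lt_exitTime (hX : IsSSRW P X) (t : ℕ) :
    MeasurableSet {ω | (t : WithTop ℕ) < exitTime D X ω} :=
  Filtration.le _ t _ ((isStoppingTime_exitTime hX D).measurableSet_gt t)

theorem integrable_norm_map [IsFiniteMeasure P] {Z : Ω → Zd d} (hZm : AEMeasurable Z P)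
    (hZ : Integrable Z P) : Integrable (fun x => ‖x‖) (P.map Z) :=
  (integrable_map_measure Measurable.of_discrete.aestronglyMeasurable hZm).2 hZ.norm

theorem potential_map {Z : Ω → Zd d} (hZm : AEMeasurable Z P) (y : Zd d) :
    potential (P.map Z) y = -∫ ω, potentialKernel d (y - Z ω) ∂P := by
  rw [potential, integral_map hZm Measurable.of_discrete.aestronglyMeasurable]

theorem abs_potentialKernel_sub_le (hd : 0 < d) (y x : Zd d) :
    |potentialKernel d (y - x)| ≤ d ^ 3 * (1 + ‖y‖) * (1 + ‖x‖) := by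
  rw [abs_of_nonneg (potentialKernel_nonneg hd _), mul_assoc]
  refine (potentialKernel_le hd _).trans ?_
  refine mul_le_mul_of_nonneg_left ((norm_sub_le _ _).trans ?_) (by positivity)
  nlinarith [norm_nonneg x, norm_nonneg y, mul_nonneg (norm_nonneg y) (norm_nonneg x)]

section Integrable

variable [IsProbabilityMeasure P] (hd : 0 < d) (hX : IsSSRW P X)
  (hZ : ∀ t, Integrable (stoppedProcess X (exitTime D X) t) P)

include hd hX hZ

theorem IsSSRW.hasPotential_stopped (t : ℕ) :
    HasPotential (P.map (stoppedProcess X (exitTime D X) t)) := by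
  have hm := (hX.measurable_stoppedProcess_exitTime (D := D) t).aemeasurable (μ := P)
  have := Measure.isProbabilityMeasure_map hm
  exact hasPotential_of_integrable_norm hd (integrable_norm_map hm (hZ t))

theorem IsSSRW.hasPotential_initial : HasPotential (P.map (X 0)) := by
  have h := hX.hasPotential_stopped hd hZ 0
  rwa [show stoppedProcess X (exitTime D X) 0 = X 0 from
    funext fun ω => stoppedProcess_eq_of_le (by simp)] at h

/-- The potential of the stopped walk decreases, at `v`, by the expected time the walk spends
in `v` before it stops. -/
theorem IsSSRW.stoppedPotential_succ (t : ℕ) (v : Zd d) :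
    stoppedPotential P X D (t + 1) v = stoppedPotential P X D t v - aliveProb P X D t v := by
  have hm := fun s => (hX.measurable_stoppedProcess_exitTime (D := D) s).aemeasurable (μ := P)
  have h := hX.setIntegral_stoppedProcess_succ hd (isStoppingTime_exitTime hX D) hZ
    (abs_potentialKernel_sub_le hd v) t MeasurableSet.univ
  rw [setIntegral_univ, setIntegral_univ, Set.univ_inter] at h
  have h2 : ∀ x, latticeAvg (fun x => potentialKernel d (v - x)) x - potentialKernel d (v - x) =
      ({v} : Set (Zd d)).indicator 1 x := by
    intro x
    rw [latticeAvg_potentialKernel_sub hd]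
    simp [Set.indicator]
  have hXv : MeasurableSet (X t ⁻¹' {v}) := hX.measurable t (measurableSet_singleton v)
  have h3 : ∫ ω in {ω | (t : WithTop ℕ) < exitTime D X ω},
      ({v} : Set (Zd d)).indicator (1 : Zd d → ℝ) (X t ω) ∂P = aliveProb P X D t v := by
    change ∫ ω in _, (X t ⁻¹' {v}).indicator (1 : Ω → ℝ) ω ∂P = _
    rw [integral_indicator_one hXv, measureReal_restrict_apply hXv, aliveProb, Set.inter_comm]
    rfl
  simp only [h2, h3] at h
  rw [stoppedPotential, stoppedPotential, potential_map (hm _), potential_map (hm _), h]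
  ring

omit hd hZ in
theorem IsSSRW.map_stopped_singleton (t : ℕ) (v : Zd d) :
    (P.map (stoppedProcess X (exitTime D X) t)).real {v} =
      aliveProb P X D t v + exitedProb P X D t v := by
  have hm := hX.measurable_stoppedProcess_exitTime (D := D) t
  have hS := hX.measurableSet_lt_exitTime (D := D) t
  rw [map_measureReal_apply hm (measurableSet_singleton v),
    ← measureReal_inter_add_sdiff (s := stoppedProcess X (exitTime D X) t ⁻¹' {v}) hS, aliveProb,
    exitedProb]
  congr 2
  · ext ω
    constructor
    · rintro ⟨h1, h2⟩
      exact ⟨h2, (stoppedProcess_eq_self (X := X) h2).symm.trans h1⟩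
    · rintro ⟨h1, h2⟩
      exact ⟨by rw [Set.mem_preimage, stoppedProcess_eq_self h1]; exact h2, h1⟩
  · ext ω
    constructor
    · rintro ⟨h1, h2⟩
      have h2' : exitTime D X ω ≤ (t : WithTop ℕ) := not_lt.1 h2
      exact ⟨h2', by rw [← stoppedProcess_of_le h2']; exact h1⟩
    · rintro ⟨h1, h2⟩
      exact ⟨by rw [Set.mem_preimage, stoppedProcess_of_le h1]; exact h2, not_lt.2 h1⟩

theorem IsSSRW.latticeAvg_stoppedPotential (t : ℕ) (v : Zd d) :
    latticeAvg (stoppedPotential P X D t) v =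
      stoppedPotential P X D (t + 1) v - exitedProb P X D t v := by
  have hm := (hX.measurable_stoppedProcess_exitTime (D := D) t).aemeasurable (μ := P)
  have := Measure.isProbabilityMeasure_map hm
  rw [hX.stoppedPotential_succ hd hZ, stoppedPotential,
    latticeAvg_potential hd (hX.hasPotential_stopped hd hZ t), hX.map_stopped_singleton]
  ring

theorem IsSSRW.antitone_stoppedPotential (v : Zd d) :
    Antitone fun t => stoppedPotential P X D t v :=
  antitone_nat_of_succ_le fun t => by
    rw [hX.stoppedPotential_succ hd hZ]
    linarith [measureReal_nonneg (μ := P)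
      (s := {ω | (t : WithTop ℕ) < exitTime D X ω ∧ X t ω = v}), aliveProb.eq_1 P X D t v]

end Integrable

theorem stoppedPotential_zero : stoppedPotential P X D 0 = potential (P.map (X 0)) := by
  have : stoppedProcess X (exitTime D X) 0 = X 0 := by
    ext ω : 1; exact stoppedProcess_eq_of_le (by simp)
  rw [stoppedPotential, this]

section UniformlyIntegrable

variable [IsProbabilityMeasure P] (hd : 0 < d) (hX : IsSSRW P X)
  (hUI : UniformIntegrable (stoppedProcess X (exitTime D X)) 1 P)

include hd hX hUI

theorem IsSSRW.ae_eventually_stoppedProcess_eq :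
    ∀ᵐ ω ∂P, ∀ᶠ t in atTop,
      stoppedProcess X (exitTime D X) t ω = stoppedValue X (exitTime D X) ω := by
  filter_upwards [hX.ae_exitTime_lt_top hd hUI] with ω hω
  obtain ⟨n, hn⟩ := WithTop.ne_top_iff_exists.1 hω.ne
  filter_upwards [eventually_ge_atTop n] with t ht
  refine stoppedProcess_of_le ?_
  rw [← hn]
  exact WithTop.coe_le_coe.2 ht

theorem IsSSRW.aemeasurable_stoppedValue : AEMeasurable (stoppedValue X (exitTime D X)) P :=
  aemeasurable_of_tendsto_metrizable_ae atTop
    (fun t => (hX.measurable_stoppedProcess_exitTime (D := D) t).aemeasurable) <| by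
      filter_upwards [hX.ae_eventually_stoppedProcess_eq hd hUI] with ω hω
      exact tendsto_const_nhds.congr' (hω.mono fun t ht => ht.symm)

theorem IsSSRW.integrable_stoppedValue : Integrable (stoppedValue X (exitTime D X)) P :=
  hUI.integrable_of_ae_tendsto (u := atTop) <| by
    filter_upwards [hX.ae_eventually_stoppedProcess_eq hd hUI] with ω hω
    exact tendsto_const_nhds.congr' (hω.mono fun t ht => ht.symm)

theorem IsSSRW.hasPotential_exitLaw : HasPotential (exitLaw P X D) := by
  have hm := hX.aemeasurable_stoppedValue hd hUI
  have : IsProbabilityMeasure (exitLaw P X D) := Measure.isProbabilityMeasure_map hm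
  exact hasPotential_of_integrable_norm hd
    (integrable_norm_map hm (hX.integrable_stoppedValue hd hUI))

/-- Uniform integrability and the linear growth of the potential kernel allow to pass to the
limit in the potentials of the stopped walk. -/
theorem IsSSRW.tendsto_stoppedPotential (v : Zd d) :
    Tendsto (fun t => stoppedPotential P X D t v) atTop (𝓝 (potential (exitLaw P X D) v)) := by
  have hZm := hX.measurable_stoppedProcess_exitTime (D := D)
  have hvm := hX.aemeasurable_stoppedValue hd hUI
  simp only [stoppedPotential, exitLaw, potential_map (hZm _).aemeasurable, potential_map hvm]
  have hlim : ∀ᵐ ω ∂P, Tendsto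
      (fun t => potentialKernel d (v - stoppedProcess X (exitTime D X) t ω)) atTop
      (𝓝 (potentialKernel d (v - stoppedValue X (exitTime D X) ω))) := by
    filter_upwards [hX.ae_eventually_stoppedProcess_eq hd hUI] with ω hω
    exact tendsto_const_nhds.congr' (hω.mono fun t ht => by simp only [ht])
  have hI := (hX.hasPotential_exitLaw hd hUI v)
  rw [exitLaw, integrable_map_measure Measurable.of_discrete.aestronglyMeasurable hvm] at hI
  have hIt : ∀ t, Integrable
      (fun ω => potentialKernel d (v - stoppedProcess X (exitTime D X) t ω)) P := fun t => by
    have h := hX.hasPotential_stopped hd (fun s => memLp_one_iff_integrable.1 (hUI.memLp s)) t v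
    rwa [integrable_map_measure Measurable.of_discrete.aestronglyMeasurable
      (hZm t).aemeasurable] at h
  have hUI' := unifIntegrable_of_linear_growth hUI.unifIntegrable
    (abs_potentialKernel_sub_le hd v) hZm
  have hL1 := tendsto_Lp_finite_of_tendsto_ae le_rfl ENNReal.one_ne_top
    (fun t => (hIt t).aestronglyMeasurable) (memLp_one_iff_integrable.2 hI) hUI' hlim
  exact (tendsto_integral_of_L1' _ hI.aestronglyMeasurable (Eventually.of_forall hIt) hL1).neg

theorem IsSSRW.exitLaw_singleton (v : Zd d) :
    (exitLaw P X D).real {v} = P.real {ω | stoppedValue X (exitTime D X) ω = v} :=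
  map_measureReal_apply_of_aemeasurable (hX.aemeasurable_stoppedValue hd hUI)
    (measurableSet_singleton v)

end UniformlyIntegrable

/-! ### Barriers of Root and Rost type -/

theorem exitedProb_eq_zero_of_isRootType (hD : IsRootType D) {n : ℕ} {v : Zd d}
    (h : ((n : ℤ) + 1, v) ∈ D) : exitedProb P X D n v = 0 := by
  rw [exitedProb, show {ω | exitTime D X ω ≤ (n : WithTop ℕ) ∧
    stoppedValue X (exitTime D X) ω = v} = ∅ from ?_, measureReal_empty]
  refine Set.eq_empty_of_forall_notMem fun ω hω => ?_
  obtain ⟨s, hs, hs'⟩ := le_natCast_cases hω.1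
  have h1 := notMem_of_exitTime_eq hs'
  have h2 : X s ω = v := by
    rw [← hω.2, stoppedValue, hs']
    rfl
  rw [h2] at h1
  exact h1 (hD _ _ h _ (by omega))

theorem aliveProb_eq_zero {s : ℕ} {v : Zd d} (h : ((s : ℤ), v) ∉ D) : aliveProb P X D s v = 0 := by
  rw [aliveProb, show {ω | (s : WithTop ℕ) < exitTime D X ω ∧ X s ω = v} = ∅ from ?_,
    measureReal_empty]
  refine Set.eq_empty_of_forall_notMem fun ω hω => h ?_
  rw [← hω.2]
  exact lt_exitTime_iff.1 hω.1 s le_rfl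

theorem exitLaw_singleton_le_of_isRostType [IsFiniteMeasure P] (hD : IsRostType D)
    (hfin : ∀ᵐ ω ∂P, exitTime D X ω < ⊤) {n : ℕ} {v : Zd d} (h : ((n : ℤ) + 1, v) ∈ D) :
    P.real {ω | stoppedValue X (exitTime D X) ω = v} ≤ exitedProb P X D n v := by
  refine ENNReal.toReal_mono (measure_ne_top _ _) (measure_mono_ae ?_)
  filter_upwards [hfin] with ω hω hv
  refine ⟨?_, hv⟩
  by_contra hlt
  obtain ⟨s, hs⟩ := WithTop.ne_top_iff_exists.1 hω.ne
  have hs' : exitTime D X ω = (s : WithTop ℕ) := hs.symm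
  rw [hs'] at hlt
  have hns : n < s := WithTop.coe_lt_coe.1 (not_le.1 hlt)
  have h1 := notMem_of_exitTime_eq hs'
  have h2 : X s ω = v := by
    rw [← (show stoppedValue X (exitTime D X) ω = v from hv), stoppedValue, hs']
    rfl
  rw [h2] at h1
  rcases (show n + 1 ≤ s from hns).eq_or_lt with rfl | hlt'
  · exact h1 (by exact_mod_cast h)
  · exact h1 (hD _ _ h _ (by omega))

end Flow

/-! ### The two stopping problems -/

section Rewards

variable {d : ℕ} {Ω : Type*} {Y : ℕ → Ω → Zd d}

theorem rootReward_eq (μ ν : Measure (Zd d)) {T t : ℕ} (ht : t ≤ T) {τ : Ω → WithTop ℕ} {ω : Ω}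
    (h : τ ω = (t : WithTop ℕ)) :
    rootReward μ ν T Y τ ω =
      (fun n => if n = 0 then potential ν else potential μ) (T - t) (Y t ω) := by
  have hv : stoppedValue Y τ ω = Y t ω := by rw [stoppedValue, h]; rfl
  have hlt : τ ω < (T : WithTop ℕ) ↔ t < T := by rw [h]; exact WithTop.coe_lt_coe
  have heq : τ ω = (T : WithTop ℕ) ↔ t = T := by rw [h]; exact WithTop.coe_inj
  simp only [rootReward, Set.indicator, Set.mem_ofPred_eq, hlt, heq, hv]
  rcases ht.eq_or_lt with rfl | h1
  · simp
  · simp [h1, h1.ne, show T - t ≠ 0 by omega]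

theorem rostReward_eq (μ ν : Measure (Zd d)) {t : ℕ} {τ : Ω → WithTop ℕ} {ω : Ω}
    (h : τ ω = (t : WithTop ℕ)) :
    rostReward μ ν Y τ ω = potential μ (Y t ω) - potential ν (Y t ω) := by
  have hv : stoppedValue Y τ ω = Y t ω := by rw [stoppedValue, h]; rfl
  rw [rostReward, hv]

end Rewards

section Barrier

variable {d : ℕ} {Ω : Type*} [MeasurableSpace Ω] {P : Measure Ω} {X : ℕ → Ω → Zd d}
  {D : Set (ℤ × Zd d)} [IsProbabilityMeasure P] (hd : 0 < d) (hX : IsSSRW P X)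
  (hUI : UniformIntegrable (stoppedProcess X (exitTime D X)) 1 P)

include hd hX hUI

theorem IsSSRW.potential_exitLaw_le (n : ℕ) (v : Zd d) :
    potential (exitLaw P X D) v ≤ stoppedPotential P X D n v :=
  (hX.antitone_stoppedPotential hd (fun t => memLp_one_iff_integrable.1 (hUI.memLp t))
    v).le_of_tendsto (hX.tendsto_stoppedPotential hd hUI v) n

/-- Off a Root-type set, the walk does not return before it stops, so that the potential of the
stopped walk has reached its limit. -/
theorem IsSSRW.stoppedPotential_eq_of_isRootType (hD : IsRootType D) {n : ℕ} {v : Zd d}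
    (h : ((n : ℤ) + 1, v) ∉ D) :
    stoppedPotential P X D (n + 1) v = potential (exitLaw P X D) v := by
  have hZ := fun t => memLp_one_iff_integrable.1 (hUI.memLp t)
  have hconst : ∀ k, stoppedPotential P X D (n + 1 + k) v = stoppedPotential P X D (n + 1) v := by
    intro k
    induction k with
    | zero => rfl
    | succ k ih =>
      rw [← add_assoc, hX.stoppedPotential_succ hd hZ, ih, aliveProb_eq_zero, sub_zero]
      intro hk
      rcases Nat.eq_zero_or_pos k with rfl | hk0
      · exact h (by exact_mod_cast hk)
      · exact h (hD _ _ hk _ (by push_cast; omega))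
  refine tendsto_nhds_unique ?_ (hX.tendsto_stoppedPotential hd hUI v)
  refine tendsto_const_nhds.congr' ?_
  filter_upwards [eventually_ge_atTop (n + 1)] with t ht
  obtain ⟨k, rfl⟩ := Nat.exists_eq_add_of_le ht
  exact (hconst k).symm

/-- Off a Rost-type set at time `n + 1`, the walk has not been there before, except possibly
after it stopped, so that the potential of the stopped walk still has its initial value. -/
theorem IsSSRW.stoppedPotential_eq_of_isRostType (hD : IsRostType D) {n : ℕ} {v : Zd d}
    (h : ((n : ℤ) + 1, v) ∉ D) : stoppedPotential P X D (n + 1) v = stoppedPotential P X D 0 v := by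
  have hZ := fun t => memLp_one_iff_integrable.1 (hUI.memLp t)
  have hconst : ∀ k ≤ n + 1, stoppedPotential P X D k v = stoppedPotential P X D 0 v := by
    intro k
    induction k with
    | zero => exact fun _ => rfl
    | succ k ih =>
      intro hk
      rw [hX.stoppedPotential_succ hd hZ, ih (by omega), aliveProb_eq_zero, sub_zero]
      exact fun hk' => h (hD _ _ hk' _ (by omega))
  exact hconst _ le_rfl

end Barrier

end

theorem mainTheorem5 (d : ℕ) (hd : 0 < d)
    (lam : Measure (Zd d)) [IsProbabilityMeasure lam]
    {Ω Ω' : Type*} [MeasurableSpace Ω] [MeasurableSpace Ω']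
    (P : Measure Ω) [IsProbabilityMeasure P] (P' : Measure Ω') [IsProbabilityMeasure P']
    -- `X` is a walk with initial law `lam`, `Y` is a walk started in `y`
    (X : ℕ → Ω → Zd d) (hX : IsSSRW P X) (hX0 : P.map (X 0) = lam)
    (Y : ℕ → Ω' → Zd d) (hY : IsSSRW P' Y) (y : Zd d) (hY0 : ∀ᵐ ω ∂P', Y 0 ω = y)
    (T : ℕ) :
    -- the limit defining the potential kernel exists
    (∀ z : Zd d, Tendsto (fun n : ℕ => expectedVisits d n 0 - expectedVisits d n z) atTop
      (𝓝 (potentialKernel d z))) ∧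
    -- the Root case
    (∀ D : Set (ℤ × Zd d), IsRootType D →
      UniformIntegrable (stoppedProcess X (exitTime D X)) 1 P →
      -- all objects are well defined
      (∀ᵐ ω ∂P, exitTime D X ω < ⊤) ∧
      HasPotential lam ∧ HasPotential (exitLaw P X D) ∧
      HasPotential (exitLaw P X (truncate D T)) ∧
      (∀ τ ∈ stoppingTimesUpTo Y hY.stronglyMeasurable T,
        Integrable (rootReward (exitLaw P X D) lam T Y τ) P') ∧
      reversedExitTime D T Y ∈ stoppingTimesUpTo Y hY.stronglyMeasurable T ∧
      -- the identity and the optimal stopping formula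
      potential (exitLaw P X (truncate D T)) y =
        ∫ ω, rootReward (exitLaw P X D) lam T Y (reversedExitTime D T Y) ω ∂P' ∧
      IsLUB ((fun τ => ∫ ω, rootReward (exitLaw P X D) lam T Y τ ω ∂P') ''
          stoppingTimesUpTo Y hY.stronglyMeasurable T)
        (potential (exitLaw P X (truncate D T)) y)) ∧
    -- the Rost case
    (∀ D : Set (ℤ × Zd d), IsRostType D →
      UniformIntegrable (stoppedProcess X (exitTime D X)) 1 P →
      -- all objects are well defined
      (∀ᵐ ω ∂P, exitTime D X ω < ⊤) ∧
      HasPotential lam ∧ HasPotential (exitLaw P X D) ∧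
      HasPotential (exitLaw P X (truncate D T)) ∧
      (∀ τ ∈ stoppingTimesUpTo Y hY.stronglyMeasurable T,
        Integrable (rostReward (exitLaw P X D) lam Y τ) P') ∧
      reversedExitTime D T Y ∈ stoppingTimesUpTo Y hY.stronglyMeasurable T ∧
      -- the identity and the optimal stopping formula
      potential (exitLaw P X D) y - potential (exitLaw P X (truncate D T)) y =
        ∫ ω, rostReward (exitLaw P X D) lam Y (reversedExitTime D T Y) ω ∂P' ∧
      IsLUB ((fun τ => ∫ ω, rostReward (exitLaw P X D) lam Y τ ω ∂P') ''
          stoppingTimesUpTo Y hY.stronglyMeasurable T)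
        (potential (exitLaw P X D) y - potential (exitLaw P X (truncate D T)) y)) := by
  subst hX0
  refine ⟨fun z => ?_, fun D hD hUI => ?_, fun D hD hUI => ?_⟩
  · rw [potentialKernel_eq_integral hd]
    exact tendsto_expectedVisits_sub hd z
  · have hZ := fun t => memLp_one_iff_integrable.1 (hUI.memLp t)
    have hpot := hX.hasPotential_stopped hd hZ
    have hlam := hX.hasPotential_initial hd hZ
    rw [exitLaw_truncate]
    -- the value function in the remaining time is the flow of potentials itself
    have h := hY.optimal_stopping hd hY0 (T := T) (D := D)
      (V := stoppedPotential P X D)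
      (G := fun n => if n = 0 then potential (P.map (X 0)) else potential (exitLaw P X D))
      (R := rootReward (exitLaw P X D) (P.map (X 0)) T Y)
      (fun τ ω t ht hτ => rootReward_eq _ _ ht hτ) (fun n v => ?_) (fun v => ?_) (fun n v => ?_)
      (fun n v hv => ?_) (fun n v hv => ?_)
    · exact ⟨hX.ae_exitTime_lt_top hd hUI, hlam, hX.hasPotential_exitLaw hd hUI, hpot T, h⟩
    · by_cases hn : n = 0
      · subst hn
        simp [stoppedPotential_zero]
      · simpa [hn] using hX.potential_exitLaw_le hd hUI n v
    · simp [stoppedPotential_zero]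
    · rw [hX.latticeAvg_stoppedPotential hd hZ]
      exact sub_le_self _ measureReal_nonneg
    · rw [hX.latticeAvg_stoppedPotential hd hZ, exitedProb_eq_zero_of_isRootType hD hv, sub_zero]
    · simp [hX.stoppedPotential_eq_of_isRootType hd hUI hD hv]
  · have hZ := fun t => memLp_one_iff_integrable.1 (hUI.memLp t)
    have hpot := hX.hasPotential_stopped hd hZ
    have hfin := hX.ae_exitTime_lt_top hd hUI
    have hlam := hX.hasPotential_initial hd hZ
    rw [exitLaw_truncate]
    have hfm : IsFiniteMeasure (exitLaw P X D) := by unfold exitLaw; infer_instance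
    have havg : ∀ (n : ℕ) v, latticeAvg
        (fun v => potential (exitLaw P X D) v - stoppedPotential P X D n v) v =
        potential (exitLaw P X D) v - stoppedPotential P X D (n + 1) v -
          (P.real {ω | stoppedValue X (exitTime D X) ω = v} - exitedProb P X D n v) := by
      intro n v
      have h1 : latticeAvg (fun v => potential (exitLaw P X D) v - stoppedPotential P X D n v) v =
          latticeAvg (potential (exitLaw P X D)) v - latticeAvg (stoppedPotential P X D n) v := by
        simp only [latticeAvg, ← mul_sub, ← Finset.sum_sub_distrib, add_sub_add_comm]
      rw [h1, hX.latticeAvg_stoppedPotential hd hZ,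
        latticeAvg_potential hd (hX.hasPotential_exitLaw hd hUI), hX.exitLaw_singleton hd hUI]
      ring
    -- the value function is minus the expected time that `X` spends in `v` from
    -- time `n` on, before it is stopped
    have h := hY.optimal_stopping hd hY0 (T := T) (D := D)
      (V := fun n v => potential (exitLaw P X D) v - stoppedPotential P X D n v)
      (G := fun _ v => potential (exitLaw P X D) v - potential (P.map (X 0)) v)
      (R := rostReward (exitLaw P X D) (P.map (X 0)) Y)
      (fun τ ω t _ hτ => rostReward_eq _ _ hτ) (fun n v => ?_) (fun v => ?_) (fun n v => ?_)
      (fun n v hv => ?_) (fun n v hv => ?_)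
    · exact ⟨hfin, hlam, hX.hasPotential_exitLaw hd hUI, hpot T, h⟩
    · have h := hX.antitone_stoppedPotential hd hZ v n.zero_le
      simp only [stoppedPotential_zero] at h
      linarith
    · rw [stoppedPotential_zero]
    · rw [havg]
      have h : exitedProb P X D n v ≤ P.real {ω | stoppedValue X (exitTime D X) ω = v} :=
        measureReal_mono fun ω hω => hω.2
      linarith
    · rw [havg]
      linarith [exitLaw_singleton_le_of_isRostType (P := P) hD hfin hv]
    · rw [hX.stoppedPotential_eq_of_isRostType hd hUI hD hv, stoppedPotential_zero]
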